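/- Let $e_1,\dots,e_4$ be the coordinate points of $\mathbb P^3=\mathbb P^3_{\mathbb C}$. Put $p_1=[1:-1:-1:-1]$, $p_2=[-1:1:-1:-1]$, $p_3=[-1:-1:1:-1]$, $p_4=[-1:-1:-1:1]$, and $q_1=[1:-1:-1:1]$, $q_2=[-1:1:-1:1]$, $q_3=[1:1:-1:-1]$, $q_4=[1:1:1:1]$. Let $R=\{e_j\}\cup\{p_j\}\cup\{q_j\}$ (twelve points), and let $\mathcal C=\{g\in \mathrm{PGL}(4,\mathbb C): g\cdot R\subseteq R\}$ be the Cremona-cubes group. An element $g\in\mathcal C$ is of type (C) if it is represented by a matrix whose columns represent the points $p_1,\dots,p_4$ and whose rows represent the points $q_1,\dots,q_4$ (in some order), or vice versa. Let $C_3\colon[x_1:x_2:x_3:x_4]\dashrightarrow[1/x_1:1/x_2:1/x_3:1/x_4]$ be the standard Cremona transformation. Let $\varepsilon\colon B\to\mathbb P^3$ be the blow-up of $\mathbb P^3$ at $R$, let $H$ be the class of the pull-back to $B$ of a plane, and let $E_j,P_j,Q_j$ be the classes of the exceptional divisors over $e_j,p_j,q_j$. These classes form a $\mathbb Z$-basis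 of $\mathrm{Cl}(B)=\mathrm{Pic}(B)\cong H^2(B,\mathbb Z)$. For a birational map $\Phi$ of $\mathbb P^3$, lifted to $B\dashrightarrow B$, let $\Phi_*=(\Phi^{-1})^*$ be the induced push-forward on this group, where $\Phi^*=(\pi_1)_*\circ(\pi_2)^*$ for the projections $\pi_1,\pi_2$ of a resolution of the closure of the graph of $\Phi$ in $B\times B$. Let $d_n^\Phi$ be the common degree of the four forms that represent $\Phi^n$, after removal of common factors, and let $S_\Phi=\lim_{n\to\infty}\frac1n\log d_n^\Phi$ be the algebraic entropy. **Proposition.** Let $g\in\mathcal C$ be of type (C) and $\Phi=g\circ C_3$. Define integers $d_n,f_n,b_n,c_n$ by $d_0=1$, $f_0=b_0=c_0=0$ and, for $n\ge1$, $$d_n=3d_{n-1}-4f_{n-1},\qquad f_n=c_{n-1},\qquad b_n=2d_{n-1}-3f_{n-1},\qquad c_n=b_{n-1}.$$ If the columns of $g$ represent the points $p_j$ (so that $g$ maps $\{e_j\}\to\{p_j\}\to\{q_j\}\to\{e_j\}$), then for all $n\ge0$ $$(\Phi_*)^nH=d_nH-f_n\sum_{j=1}^4E_j-b_n\sum_{j=1}^4P_j-c_n\sum_{j=1}^4Q_j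 .$$ If instead the columns of $g$ represent the points $q_j$, then the same formula holds with the $P_j$ and the $Q_j$ interchanged. In both cases, for all $n\ge 0$, $$d_n^\Phi=d_n=\tfrac85\left(\varphi^{2n}+\varphi^{-2n}\right)-\tfrac15(-1)^n-2,$$ where $\varphi=\frac{1+\sqrt5}2$ is the golden ratio. Hence the algebraic entropy of $\Phi$ is $S_\Phi=2\log\varphi>0$, and $\Phi$ is non-integrable. -/

import Mathlib

open MvPolynomial Filter Topology
open scoped LinearAlgebra.Projectivization MatrixGroups

namespace CremonaCubes

/-- The homogeneous coordinate ring `ℂ[x₁, x₂, x₃, x₄]` of `ℙ³`. -/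
abbrev Poly : Type := MvPolynomial (Fin 4) ℂ

/-- The complex projective space `ℙ³`. -/
abbrev P3 : Type := ℙ ℂ (Fin 4 → ℂ)

/-! ### Birational maps of `ℙ³` -/

/-- A birational self-map of `ℙ³`, given by four forms of the same degree (common factors are
allowed), together with four forms representing the inverse map: each of the two composites
is `x ↦ κ(x) x` for some nonzero form `κ`. -/
structure BirMap where
  /-- The forms representing the map. -/
  toFun : Fin 4 → Poly
  /-- The forms representing the inverse map. -/
  invFun : Fin 4 → Poly
  hom_toFun : ∃ d, ∀ i, (toFun i).IsHomogeneous d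
  hom_invFun : ∃ d, ∀ i, (invFun i).IsHomogeneous d
  inv_comp : ∃ (κ : Poly) (e : ℕ), κ ≠ 0 ∧ κ.IsHomogeneous e ∧
    ∀ i, aeval toFun (invFun i) = κ * X i
  comp_inv : ∃ (κ : Poly) (e : ℕ), κ ≠ 0 ∧ κ.IsHomogeneous e ∧
    ∀ i, aeval invFun (toFun i) = κ * X i

namespace BirMap

/-- The inverse birational map. -/
def symm (Φ : BirMap) : BirMap where
  toFun := Φ.invFun
  invFun := Φ.toFun
  hom_toFun := Φ.hom_invFun
  hom_invFun := Φ.hom_toFun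
  inv_comp := Φ.comp_inv
  comp_inv := Φ.inv_comp

/-- The identity map. -/
noncomputable def id : BirMap where
  toFun := X
  invFun := X
  hom_toFun := ⟨1, fun i => isHomogeneous_X ℂ i⟩
  hom_invFun := ⟨1, fun i => isHomogeneous_X ℂ i⟩
  inv_comp := ⟨1, 0, one_ne_zero, isHomogeneous_one _ _, fun i => by simp⟩
  comp_inv := ⟨1, 0, one_ne_zero, isHomogeneous_one _ _, fun i => by simp⟩

lemma aeval_mul_X {κ p : Poly} {d : ℕ} (hp : p.IsHomogeneous d) :
    aeval (fun i => κ * X i : Fin 4 → Poly) p = κ ^ d * p := by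
  conv_rhs => rw [p.as_sum]
  conv_lhs => rw [p.as_sum]
  rw [map_sum, Finset.mul_sum]
  refine Finset.sum_congr rfl fun m hm => ?_
  have hd : m.degree = d := by
    by_contra h
    exact (mem_support_iff.mp hm) (hp.coeff_eq_zero h)
  rw [aeval_monomial, monomial_eq, ← hd, Finsupp.degree_apply]
  simp only [mul_pow, Finsupp.prod, Finset.prod_mul_distrib, Finset.prod_pow_eq_pow_sum,
    MvPolynomial.algebraMap_eq]
  ring

/-- A birational map is dominant: no nonzero form vanishes on its image. -/
lemma aeval_ne_zero (Φ : BirMap) {p : Poly} {d : ℕ} (hp : p.IsHomogeneous d) (h0 : p ≠ 0) :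
    aeval Φ.toFun p ≠ 0 := by
  obtain ⟨κ, e, hκ, -, h⟩ := Φ.comp_inv
  intro h1
  have h2 : aeval Φ.invFun (aeval Φ.toFun p) = κ ^ d * p := by
    rw [← aeval_mul_X hp, ← AlgHom.comp_apply]
    refine congrArg (fun f : Poly →ₐ[ℂ] Poly => f _) (algHom_ext fun i => ?_)
    rw [AlgHom.comp_apply, aeval_X, aeval_X, h]
  rw [h1, map_zero] at h2
  exact mul_ne_zero (pow_ne_zero _ hκ) h0 h2.symm

lemma comp_aux (Φ Ψ : BirMap) : ∃ (κ : Poly) (e : ℕ), κ ≠ 0 ∧ κ.IsHomogeneous e ∧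
    ∀ i, aeval (fun j => aeval Ψ.toFun (Φ.toFun j)) (aeval Φ.invFun (Ψ.invFun i)) = κ * X i := by
  obtain ⟨κ, e, hκ, hκe, h⟩ := Φ.inv_comp
  obtain ⟨κ', e', hκ', hκe', h'⟩ := Ψ.inv_comp
  obtain ⟨d, hd⟩ := Ψ.hom_toFun
  obtain ⟨d', hd'⟩ := Ψ.hom_invFun
  refine ⟨(aeval Ψ.toFun κ) ^ d' * κ', (d * e) * d' + e',
    mul_ne_zero (pow_ne_zero _ (Ψ.aeval_ne_zero hκe hκ)) hκ',
    ((hκe.aeval Ψ.toFun hd).pow d').mul hκe', fun i => ?_⟩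
  have h1 : aeval Φ.toFun (aeval Φ.invFun (Ψ.invFun i)) = κ ^ d' * Ψ.invFun i := by
    rw [← aeval_mul_X (hd' i), ← AlgHom.comp_apply]
    refine congrArg (fun f : Poly →ₐ[ℂ] Poly => f _) (algHom_ext fun i => ?_)
    rw [AlgHom.comp_apply, aeval_X, aeval_X, h]
  have h2 : ∀ q : Poly, aeval (fun j => aeval Ψ.toFun (Φ.toFun j)) q
      = aeval Ψ.toFun (aeval Φ.toFun q) := by
    intro q
    rw [← AlgHom.comp_apply]
    congr 1
    ext i : 1
    simp
  rw [h2, h1, map_mul, map_pow, h', mul_assoc]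

/-- The composite `Φ ∘ Ψ`. -/
noncomputable def comp (Φ Ψ : BirMap) : BirMap where
  toFun i := aeval Ψ.toFun (Φ.toFun i)
  invFun i := aeval Φ.invFun (Ψ.invFun i)
  hom_toFun := by
    obtain ⟨d, hd⟩ := Φ.hom_toFun
    obtain ⟨e, he⟩ := Ψ.hom_toFun
    exact ⟨e * d, fun i => (hd i).aeval _ he⟩
  hom_invFun := by
    obtain ⟨d, hd⟩ := Φ.hom_invFun
    obtain ⟨e, he⟩ := Ψ.hom_invFun
    exact ⟨d * e, fun i => (he i).aeval _ hd⟩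
  inv_comp := comp_aux Φ Ψ
  comp_inv := comp_aux Ψ.symm Φ.symm

/-- The iterates `Φⁿ`. -/
noncomputable def iterate (Φ : BirMap) : ℕ → BirMap
  | 0 => id
  | n + 1 => Φ.comp (Φ.iterate n)

/-- The degree `d^Φ`: the common degree `d` of four forms `P₁, …, P₄` without common factor
that represent the same rational map as `Φ`. -/
noncomputable def degree (Φ : BirMap) : ℕ :=
  sInf {d | ∃ P : Fin 4 → Poly, (∀ i, (P i).IsHomogeneous d) ∧
    (∀ c, (∀ i, c ∣ P i) → IsUnit c) ∧ ∀ i j, P i * Φ.toFun j = P j * Φ.toFun i}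

/-- `S` is the algebraic entropy `lim (1/n) log d_n` of `Φ`, where `d_n` is the degree of `Φⁿ`. -/
def HasAlgebraicEntropy (Φ : BirMap) (S : ℝ) : Prop :=
  Tendsto (fun n : ℕ => 1 / (n : ℝ) * Real.log ((Φ.iterate n).degree : ℝ)) atTop (𝓝 S)

end BirMap

/-- The projectivity of `ℙ³` represented by an invertible matrix. -/
noncomputable def projectivity (A : GL (Fin 4) ℂ) : BirMap where
  toFun i := ∑ j, C ((A : Matrix (Fin 4) (Fin 4) ℂ) i j) * X j
  invFun i := ∑ j, C (((A⁻¹ : GL (Fin 4) ℂ) : Matrix (Fin 4) (Fin 4) ℂ) i j) * X j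
  hom_toFun := ⟨1, fun _ => IsHomogeneous.sum _ _ _ fun j _ => isHomogeneous_C_mul_X _ j⟩
  hom_invFun := ⟨1, fun _ => IsHomogeneous.sum _ _ _ fun j _ => isHomogeneous_C_mul_X _ j⟩
  inv_comp := ⟨1, 0, one_ne_zero, isHomogeneous_one _ _, fun i => by
    have h : ((A⁻¹ : GL (Fin 4) ℂ) : Matrix (Fin 4) (Fin 4) ℂ) * A = 1 := by
      rw [← Units.val_mul, inv_mul_cancel, Units.val_one]
    simp only [map_sum, map_mul, aeval_X, algHom_C, algebraMap_eq, Finset.mul_sum, one_mul]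
    rw [Finset.sum_comm]
    simp only [← mul_assoc, ← C_mul, ← Finset.sum_mul, ← map_sum]
    simp only [← Matrix.mul_apply, h, Matrix.one_apply]
    simp⟩
  comp_inv := ⟨1, 0, one_ne_zero, isHomogeneous_one _ _, fun i => by
    have h : (A : Matrix (Fin 4) (Fin 4) ℂ) * ((A⁻¹ : GL (Fin 4) ℂ) : Matrix (Fin 4) (Fin 4) ℂ)
        = 1 := by
      rw [← Units.val_mul, mul_inv_cancel, Units.val_one]
    simp only [map_sum, map_mul, aeval_X, algHom_C, algebraMap_eq, Finset.mul_sum, one_mul]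
    rw [Finset.sum_comm]
    simp only [← mul_assoc, ← C_mul, ← Finset.sum_mul, ← map_sum]
    simp only [← Matrix.mul_apply, h, Matrix.one_apply]
    simp⟩

lemma cremona_aux : ∃ (κ : Poly) (e : ℕ), κ ≠ 0 ∧ κ.IsHomogeneous e ∧
    ∀ i : Fin 4, aeval (fun i : Fin 4 => ∏ j ∈ Finset.univ.erase i, (X j : Poly))
      (∏ j ∈ Finset.univ.erase i, (X j : Poly)) = κ * X i := by
  refine ⟨(X 0 * X 1 * X 2 * X 3) ^ 2, 8, pow_ne_zero _ ?_, ?_, fun i => ?_⟩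
  · simp [X_ne_zero]
  · exact ((((isHomogeneous_X ℂ 0).mul (isHomogeneous_X ℂ 1)).mul (isHomogeneous_X ℂ 2)).mul
      (isHomogeneous_X ℂ 3)).pow 2
  · have h0 : (Finset.univ.erase 0 : Finset (Fin 4)) = {1, 2, 3} := by decide
    have h1 : (Finset.univ.erase 1 : Finset (Fin 4)) = {0, 2, 3} := by decide
    have h2 : (Finset.univ.erase 2 : Finset (Fin 4)) = {0, 1, 3} := by decide
    have h3 : (Finset.univ.erase 3 : Finset (Fin 4)) = {0, 1, 2} := by decide
    fin_cases i <;> simp [h0, h1, h2, h3] <;> ring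

/-- The standard Cremona transformation
`[x₁ : x₂ : x₃ : x₄] ↦ [1/x₁ : 1/x₂ : 1/x₃ : 1/x₄] = [x₂x₃x₄ : x₁x₃x₄ : x₁x₂x₄ : x₁x₂x₃]`. -/
noncomputable def cremona : BirMap where
  toFun i := ∏ j ∈ Finset.univ.erase i, X j
  invFun i := ∏ j ∈ Finset.univ.erase i, X j
  hom_toFun := ⟨3, fun i => by
    simpa using IsHomogeneous.prod (Finset.univ.erase i) (fun j => (X j : Poly)) (fun _ => 1)
      fun j _ => isHomogeneous_X ℂ j⟩
  hom_invFun := ⟨3, fun i => by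
    simpa using IsHomogeneous.prod (Finset.univ.erase i) (fun j => (X j : Poly)) (fun _ => 1)
      fun j _ => isHomogeneous_X ℂ j⟩
  inv_comp := cremona_aux
  comp_inv := cremona_aux

/-! ### Divisors on the blow-up of `ℙ³` at a finite set of points -/

/-- An irreducible surface in `ℙ³`: an irreducible form up to a nonzero constant. -/
@[ext]
structure Surface where
  /-- The equation up to a nonzero constant. -/
  cls : Associates Poly
  irreducible_cls : Irreducible cls
  exists_form : ∃ (s : Poly) (d : ℕ), s.IsHomogeneous d ∧ Associates.mk s = cls

namespace Surface

/-- An equation of the surface. -/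
noncomputable def form (S : Surface) : Poly := S.exists_form.choose

lemma form_hom (S : Surface) : ∃ d, S.form.IsHomogeneous d :=
  S.exists_form.choose_spec.imp fun _ h => h.1

lemma mk_form (S : Surface) : Associates.mk S.form = S.cls :=
  S.exists_form.choose_spec.choose_spec.2

lemma irreducible_form (S : Surface) : Irreducible S.form := by
  rw [← Associates.irreducible_mk, mk_form]
  exact S.irreducible_cls

end Surface

/-- The order of vanishing at the vector `v` of the polynomial function `p` on `ℂ⁴`, i.e. the least
degree of a term in its Taylor expansion at `v`. For a form `p` and `v ≠ 0` this is the
multiplicity of the surface `p = 0` of `ℙ³` at the point `[v]`. -/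
noncomputable def ordAt (v : Fin 4 → ℂ) (p : Poly) : ℕ∞ :=
  ((aeval (fun i => X i + C (v i)) p : Poly) : MvPowerSeries (Fin 4) ℂ).order

/-- The prime divisors of the blow-up `ε : Bl_Z ℙ³ → ℙ³` at a finite set of points `Z`: the strict
transforms of the irreducible surfaces of `ℙ³`, and the exceptional divisors over the points
of `Z`. -/
inductive PrimeDivisor (Z : Finset P3) : Type
  | strict (S : Surface) : PrimeDivisor Z
  | exc (a : Z) : PrimeDivisor Z

/-- The discrete valuation attached to a prime divisor `D` of `Bl_Z ℙ³`, evaluated at a form `p`: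
the order of vanishing of `ε^* p` along `D`. This is the exponent of the equation of `S` in `p` if
`D` is the strict transform of `S`, and the multiplicity of `p` at `a` if `D` is the
exceptional divisor over `a`. -/
noncomputable def PrimeDivisor.ord {Z : Finset P3} : PrimeDivisor Z → Poly → ℕ∞
  | strict S, p => emultiplicity S.form p
  | exc a, p => ordAt a.1.rep p

/-- The group of divisors of `Bl_Z ℙ³`. -/
abbrev Divisor (Z : Finset P3) : Type := PrimeDivisor Z →₀ ℤ

section Facts

lemma ordAt_mul (v : Fin 4 → ℂ) (p q : Poly) : ordAt v (p * q) = ordAt v p + ordAt v q := by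
  simp [ordAt, MvPowerSeries.order_mul]

lemma ordAt_ne_top (v : Fin 4 → ℂ) {p : Poly} (hp : p ≠ 0) : ordAt v p ≠ ⊤ := by
  rw [ordAt, Ne, MvPowerSeries.order_eq_top_iff, MvPolynomial.coe_eq_zero_iff]
  intro h
  apply hp
  have h2 : aeval (fun i => X i - C (v i) : Fin 4 → Poly)
      (aeval (fun i => X i + C (v i) : Fin 4 → Poly) p) = p := by
    rw [← AlgHom.comp_apply]
    conv_rhs => rw [← AlgHom.id_apply (R := ℂ) p]
    congr 1
    ext i : 1
    simp
  rw [← h2, h, map_zero]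

lemma PrimeDivisor.ord_mul {Z : Finset P3} (D : PrimeDivisor Z) (p q : Poly) :
    D.ord (p * q) = D.ord p + D.ord q := by
  cases D with
  | strict S => exact emultiplicity_mul S.irreducible_form.prime
  | exc a => exact ordAt_mul _ _ _

lemma PrimeDivisor.ord_ne_top {Z : Finset P3} (D : PrimeDivisor Z) {p : Poly} (hp : p ≠ 0) :
    D.ord p ≠ ⊤ := by
  cases D with
  | strict S =>
    exact finiteMultiplicity_iff_emultiplicity_ne_top.mp
      (FiniteMultiplicity.of_not_isUnit S.irreducible_form.not_isUnit hp)
  | exc a => exact ordAt_ne_top _ hp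

lemma PrimeDivisor.finite_ord_ne_zero {Z : Finset P3} {p : Poly} (hp : p ≠ 0) :
    {D : PrimeDivisor Z | D.ord p ≠ 0}.Finite := by
  classical
  have hfin : {S : Surface | S.form ∣ p}.Finite := by
    have hp' : Associates.mk p ≠ 0 := Associates.mk_ne_zero.mpr hp
    let hF := UniqueFactorizationMonoid.fintypeSubtypeDvd (Associates.mk p) hp'
    have hF' : {c | c ∣ Associates.mk p}.Finite := Set.finite_coe_iff.mp (@Finite.of_fintype _ hF)
    refine Set.Finite.of_injOn (f := fun S : Surface => S.cls) (t := {c | c ∣ Associates.mk p})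
      (fun S hS => ?_) (fun S _ T _ h => Surface.ext h) hF'
    change S.cls ∣ Associates.mk p
    rw [← S.mk_form]
    exact Associates.mk_dvd_mk.mpr hS
  refine ((hfin.image PrimeDivisor.strict).union
    (Set.finite_range (PrimeDivisor.exc (Z := Z)))).subset ?_
  rintro (S | a) hD
  · left
    refine ⟨S, ?_, rfl⟩
    by_contra h
    exact hD (emultiplicity_eq_zero.mpr h)
  · right
    exact ⟨a, rfl⟩

lemma finite_support_of_le {Z : Finset P3} {p : Poly} (hp : p ≠ 0) (f : PrimeDivisor Z → ℕ∞)
    (hf : ∀ D, f D ≤ D.ord p) : (Function.support fun D => ((f D).toNat : ℤ)).Finite := by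
  refine (PrimeDivisor.finite_ord_ne_zero (Z := Z) hp).subset fun D hD h => hD ?_
  have h0 : f D = 0 := le_antisymm (h ▸ hf D) bot_le
  simp [h0]

lemma BirMap.exists_ne_zero (Φ : BirMap) : ∃ i, Φ.toFun i ≠ 0 := by
  refine ⟨0, ?_⟩
  have := Φ.aeval_ne_zero (isHomogeneous_X ℂ 0) (X_ne_zero 0)
  rwa [aeval_X] at this

/-- The linear form with coefficient vector `l`. -/
noncomputable def linForm (l : Fin 4 → ℂ) : Poly := ∑ i, C (l i) * X i

lemma linForm_hom (l : Fin 4 → ℂ) : (linForm l).IsHomogeneous 1 :=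
  IsHomogeneous.sum _ _ _ fun j _ => isHomogeneous_C_mul_X _ j

/-- There is a nonzero linear form vanishing at a given vector. -/
lemma exists_linForm (v : Fin 4 → ℂ) : ∃ l : {l : Fin 4 → ℂ // ∑ i, l i * v i = 0},
    linForm l.1 ≠ 0 := by
  have key : ∀ (l : Fin 4 → ℂ) (i : Fin 4), l i ≠ 0 → linForm l ≠ 0 := by
    intro l i hi h
    apply hi
    have := congrArg (eval (Pi.single i 1 : Fin 4 → ℂ)) h
    simpa [linForm, Pi.single_apply] using this
  by_cases h : v 0 = 0
  · exact ⟨⟨Pi.single 0 1, by simp [Pi.single_apply, h]⟩, key _ 0 (by simp)⟩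
  · exact ⟨⟨![v 1, -v 0, 0, 0], by simp [Fin.sum_univ_four]; ring⟩, key _ 1 (by simpa using h)⟩

end Facts

/-- The divisor `ε^*{p = 0} = ∑_D ord_D(p) D` on `Bl_Z ℙ³` of a nonzero form `p`. -/
noncomputable def divForm (Z : Finset P3) (p : Poly) (hp : p ≠ 0) : Divisor Z :=
  Finsupp.ofSupportFinite (fun D => ((D.ord p).toNat : ℤ))
    (finite_support_of_le hp _ fun _ => le_rfl)

/-- Principal divisors: the divisors of the nonzero rational functions `p / q`, with `p` and `q`
nonzero forms of the same degree. -/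
noncomputable def principal (Z : Finset P3) : AddSubgroup (Divisor Z) :=
  AddSubgroup.closure {D | ∃ (d : ℕ) (p q : Poly) (hp : p ≠ 0) (hq : q ≠ 0),
    p.IsHomogeneous d ∧ q.IsHomogeneous d ∧ D = divForm Z p hp - divForm Z q hq}

/-- The divisor class group of `Bl_Z ℙ³`. As `Bl_Z ℙ³` is smooth, projective and rational, this is
`Pic(Bl_Z ℙ³)`, which the first Chern class identifies with `H²(Bl_Z ℙ³, ℤ)`. -/
abbrev DivClassGroup (Z : Finset P3) : Type := Divisor Z ⧸ principal Z

/-! ### Pull-back and push-forward of divisors by a birational map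

A birational map `Φ` of `ℙ³` induces a birational map `Φ : X ⇢ X` of `X = Bl_Z ℙ³`, which is regular
at the generic point of each prime divisor `D` of `X`. If `π₁, π₂` are the projections of (a
resolution of) the closed graph, then `Φ^* = (π₁)_* (π₂)^*`, so the multiplicity of `D` in `Φ^* W` is
`ord_D` of the pull-back by `Φ` of a local equation of the divisor `W`. -/

/-- The fixed part on `Bl_Z ℙ³` of the linear system spanned by the forms `F₁, …, F₄` that represent
`Φ`: along `D` these forms vanish simultaneously to the order `min_i ord_D(F_i)`. -/
noncomputable def fixedPart (Z : Finset P3) (Φ : BirMap) : Divisor Z :=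
  Finsupp.ofSupportFinite (fun D => ((⨅ i, D.ord (Φ.toFun i)).toNat : ℤ))
    (finite_support_of_le Φ.exists_ne_zero.choose_spec _ fun _ => iInf_le _ _)

/-- `Φ^* ε^* {p = 0}` for a nonzero form `p`: the order along `D` is
`ord_D(p(F₁, …, F₄)) - deg(p) min_i ord_D(F_i)`. -/
noncomputable def pullForm (Z : Finset P3) (Φ : BirMap) (p : Poly) (hp : p ≠ 0)
    (hom : ∃ d, p.IsHomogeneous d) : Divisor Z :=
  divForm Z (aeval Φ.toFun p) (Φ.aeval_ne_zero hom.choose_spec hp)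
    - p.totalDegree • fixedPart Z Φ

/-- `Φ^* E_a` for the exceptional divisor `E_a` over `a ∈ Z`. The ideal of `E_a` is generated by the
pull-backs of the quotients `l / l'` of linear forms with `l(a) = 0 ≠ l'(a)`, so that the order along
`D` is `min_{l(a) = 0} ord_D(l(F₁, …, F₄)) - min_i ord_D(F_i)`. -/
noncomputable def pullExc (Z : Finset P3) (Φ : BirMap) (a : Z) : Divisor Z :=
  Finsupp.ofSupportFinite
    (fun D => ((⨅ l : {l : Fin 4 → ℂ // ∑ i, l i * a.1.rep i = 0},
      D.ord (aeval Φ.toFun (linForm l.1))).toNat : ℤ))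
    (finite_support_of_le
      (Φ.aeval_ne_zero (linForm_hom _) (exists_linForm a.1.rep).choose_spec) _
      fun D => iInf_le (fun l : {l : Fin 4 → ℂ // ∑ i, l i * a.1.rep i = 0} =>
        D.ord (aeval Φ.toFun (linForm l.1))) _)
    - fixedPart Z Φ

/-- The pull-back `Φ^*` of a prime divisor. The strict transform of `S` is
`ε^* S - ∑_a mult_a(S) E_a`. -/
noncomputable def pullPrime (Z : Finset P3) (Φ : BirMap) : PrimeDivisor Z → Divisor Z
  | .strict S => pullForm Z Φ S.form S.irreducible_form.ne_zero S.form_hom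
      - ∑ a : Z, (ordAt a.1.rep S.form).toNat • pullExc Z Φ a
  | .exc a => pullExc Z Φ a

/-- The pull-back `Φ^*` of divisors on `Bl_Z ℙ³`. -/
noncomputable def pullDiv (Z : Finset P3) (Φ : BirMap) : Divisor Z →+ Divisor Z :=
  Finsupp.liftAddHom fun D => (zmultiplesHom (Divisor Z)) (pullPrime Z Φ D)

section Descent

lemma isHomogeneous_of_mul {p q : Poly} {d : ℕ} (h : (p * q).IsHomogeneous d) (hp : p ≠ 0)
    (hq : q ≠ 0) : p.IsHomogeneous p.totalDegree := by
  have ord_le : ∀ r : Poly, r ≠ 0 → (r : MvPowerSeries (Fin 4) ℂ).order ≤ r.totalDegree := by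
    intro r hr
    obtain ⟨m, hm⟩ := support_nonempty.mpr hr
    refine (MvPowerSeries.order_le (d := m) ?_).trans ?_
    · rw [coeff_coe]
      exact mem_support_iff.mp hm
    · exact_mod_cast by simpa [Finsupp.degree_apply, Finsupp.sum] using le_totalDegree hm
  have h1 : ((p * q : Poly) : MvPowerSeries (Fin 4) ℂ).order
      = (p : MvPowerSeries (Fin 4) ℂ).order + (q : MvPowerSeries (Fin 4) ℂ).order := by
    rw [MvPolynomial.coe_mul, MvPowerSeries.order_mul]
  have h2 : ((p.totalDegree + q.totalDegree : ℕ) : ℕ∞)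
      ≤ ((p * q : Poly) : MvPowerSeries (Fin 4) ℂ).order := by
    rw [← totalDegree_mul_of_isDomain hp hq, h.totalDegree (mul_ne_zero hp hq)]
    refine MvPowerSeries.nat_le_order fun m hm => ?_
    rw [coeff_coe]
    exact h.coeff_eq_zero hm.ne
  have hpo := ord_le p hp
  have hqo := ord_le q hq
  rw [h1] at h2
  have h3 : (p.totalDegree : ℕ∞) ≤ (p : MvPowerSeries (Fin 4) ℂ).order := by
    generalize (p : MvPowerSeries (Fin 4) ℂ).order = a at *
    generalize (q : MvPowerSeries (Fin 4) ℂ).order = b at *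
    lift a to ℕ using ne_top_of_le_ne_top (ENat.natCast_ne_top _) hpo
    lift b to ℕ using ne_top_of_le_ne_top (ENat.natCast_ne_top _) hqo
    norm_cast at *
    omega
  rw [IsHomogeneous, IsWeightedHomogeneous]
  intro m hm
  have h4 : (p : MvPowerSeries (Fin 4) ℂ).order ≤ m.degree :=
    MvPowerSeries.order_le (by rwa [coeff_coe])
  have h5 : m.degree ≤ p.totalDegree := by
    simpa [Finsupp.degree_apply, Finsupp.sum] using le_totalDegree (mem_support_iff.mpr hm)
  have h6 : p.totalDegree ≤ m.degree := by exact_mod_cast h3.trans h4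
  change Finsupp.weight (fun _ => 1) m = _
  rw [← Finsupp.degree_eq_weight_one]
  exact le_antisymm h5 h6

lemma divForm_mul (Z : Finset P3) {p q : Poly} (hp : p ≠ 0) (hq : q ≠ 0) :
    divForm Z (p * q) (mul_ne_zero hp hq) = divForm Z p hp + divForm Z q hq := by
  ext D
  change (((D.ord (p * q)).toNat : ℕ) : ℤ) = ((D.ord p).toNat : ℤ) + ((D.ord q).toNat : ℤ)
  rw [D.ord_mul, ENat.toNat_add (D.ord_ne_top hp) (D.ord_ne_top hq)]
  push_cast
  rfl

lemma divForm_congr (Z : Finset P3) {p q : Poly} (hp : p ≠ 0) (h : p = q) :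
    divForm Z p hp = divForm Z q (h ▸ hp) := by
  subst h
  rfl

lemma divForm_unit (Z : Finset P3) {p : Poly} (hp : p ≠ 0) (hu : IsUnit p) :
    divForm Z p hp = 0 := by
  obtain ⟨q, hq⟩ := hu.exists_right_inv
  ext D
  have h1 : D.ord (1 : Poly) = 0 := by
    have h := D.ord_mul 1 1
    have ht := D.ord_ne_top (one_ne_zero (α := Poly))
    rw [mul_one] at h
    generalize D.ord (1 : Poly) = a at *
    lift a to ℕ using ht
    norm_cast at *
    omega
  have h2 := D.ord_mul p q
  rw [hq, h1] at h2
  change (((D.ord p).toNat : ℕ) : ℤ) = 0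
  rw [(add_eq_zero.mp h2.symm).1]
  rfl

lemma pullForm_mul (Z : Finset P3) (Φ : BirMap) {p q : Poly} (hp : p ≠ 0) (hq : q ≠ 0)
    (hom_p : ∃ d, p.IsHomogeneous d) (hom_q : ∃ d, q.IsHomogeneous d)
    (hom : ∃ d, (p * q).IsHomogeneous d) :
    pullForm Z Φ (p * q) (mul_ne_zero hp hq) hom
      = pullForm Z Φ p hp hom_p + pullForm Z Φ q hq hom_q := by
  unfold pullForm
  rw [divForm_congr Z _ (map_mul (aeval Φ.toFun) p q), divForm_mul, totalDegree_mul_of_isDomain hp hq,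
    add_smul]
  · abel_nf
  · exact Φ.aeval_ne_zero hom_p.choose_spec hp
  · exact Φ.aeval_ne_zero hom_q.choose_spec hq

lemma pullForm_congr (Z : Finset P3) (Φ : BirMap) {p q : Poly} (hp : p ≠ 0)
    (hom : ∃ d, p.IsHomogeneous d) (h : p = q) :
    pullForm Z Φ p hp hom = pullForm Z Φ q (h ▸ hp) (h ▸ hom) := by
  subst h
  rfl

lemma pullForm_unit (Z : Finset P3) (Φ : BirMap) {p : Poly} (hp : p ≠ 0)
    (hom : ∃ d, p.IsHomogeneous d) (hu : IsUnit p) : pullForm Z Φ p hp hom = 0 := by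
  unfold pullForm
  rw [divForm_unit Z _ (hu.map (aeval Φ.toFun)), (MvPolynomial.isUnit_iff_totalDegree_of_isReduced.mp hu).2]
  simp

lemma pullDiv_single (Z : Finset P3) (Φ : BirMap) (D : PrimeDivisor Z) (n : ℤ) :
    pullDiv Z Φ (Finsupp.single D n) = n • pullPrime Z Φ D := by
  simp [pullDiv]

lemma divForm_surface (Z : Finset P3) (S : Surface) :
    divForm Z S.form S.irreducible_form.ne_zero = Finsupp.single (.strict S) 1
      + ∑ a : Z, Finsupp.single (.exc a) ((ordAt a.1.rep S.form).toNat : ℤ) := by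
  classical
  ext D
  rw [Finsupp.add_apply, Finsupp.finsetSum_apply]
  change (((D.ord S.form).toNat : ℕ) : ℤ) = _
  cases D with
  | strict T =>
    rcases eq_or_ne S T with rfl | hST
    · have : emultiplicity S.form S.form = 1 :=
        (FiniteMultiplicity.of_not_isUnit S.irreducible_form.not_isUnit
          S.irreducible_form.ne_zero).emultiplicity_self
      simp [PrimeDivisor.ord, this]
    · have : emultiplicity T.form S.form = 0 := by
        refine emultiplicity_eq_zero.mpr fun h => hST ?_
        have := (T.irreducible_form.associated_of_dvd S.irreducible_form h)
        exact Surface.ext (by rw [← S.mk_form, ← T.mk_form, Associates.mk_eq_mk_iff_associated.mpr this])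
      simp [PrimeDivisor.ord, this, hST]
  | exc a =>
    simp [PrimeDivisor.ord, Finsupp.single_apply]

lemma pullDiv_divForm (Z : Finset P3) (Φ : BirMap) (p : Poly) (hp : p ≠ 0)
    (hom : ∃ d, p.IsHomogeneous d) : pullDiv Z Φ (divForm Z p hp) = pullForm Z Φ p hp hom := by
  induction p using UniqueFactorizationMonoid.induction_on_prime with
  | h₁ => exact absurd rfl hp
  | h₂ u hu => rw [divForm_unit Z hp hu, pullForm_unit Z Φ hp hom hu, map_zero]
  | h₃ q s hq hs ih =>
    obtain ⟨d, hd⟩ := hom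
    have hs0 := hs.ne_zero
    have hom_s : ∃ d, s.IsHomogeneous d := ⟨_, isHomogeneous_of_mul hd hs0 hq⟩
    have hom_q : ∃ d, q.IsHomogeneous d :=
      ⟨_, isHomogeneous_of_mul (by rwa [mul_comm] at hd) hq hs0⟩
    rw [divForm_mul Z hs0 hq, map_add, ih hq hom_q, pullForm_mul Z Φ hs0 hq hom_s hom_q ⟨d, hd⟩]
    congr 1
    let S : Surface := ⟨Associates.mk s, Associates.irreducible_mk.mpr hs.irreducible,
      s, _, hom_s.choose_spec, rfl⟩
    have hass : Associated S.form s := Associates.mk_eq_mk_iff_associated.mp S.mk_form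
    obtain ⟨u, hu⟩ := hass
    have hu0 : (u : Poly) ≠ 0 := u.ne_zero
    have hS0 := S.irreducible_form.ne_zero
    have hom_u : ∃ d, (u : Poly).IsHomogeneous d :=
      ⟨_, isHomogeneous_of_mul (q := S.form) (by
        rw [mul_comm, hu]; exact hom_s.choose_spec) hu0 hS0⟩
    rw [divForm_congr Z hs0 hu.symm, pullForm_congr Z Φ hs0 hom_s hu.symm, divForm_mul Z hS0 hu0, divForm_unit Z hu0 u.isUnit, add_zero,
      pullForm_mul Z Φ hS0 hu0 S.form_hom hom_u (hu ▸ hom_s), pullForm_unit Z Φ hu0 hom_u u.isUnit, add_zero,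
      divForm_surface, map_add, map_sum, pullDiv_single]
    simp only [pullDiv_single, pullPrime, one_smul, natCast_zsmul]
    abel

lemma principal_le (Z : Finset P3) (Φ : BirMap) :
    principal Z ≤ (principal Z).comap (pullDiv Z Φ) := by
  refine (AddSubgroup.closure_le _).mpr ?_
  rintro _ ⟨d, p, q, hp, hq, hpd, hqd, rfl⟩
  obtain ⟨e, he⟩ := Φ.hom_toFun
  refine AddSubgroup.subset_closure ⟨e * d, aeval Φ.toFun p, aeval Φ.toFun q,
    Φ.aeval_ne_zero hpd hp, Φ.aeval_ne_zero hqd hq, hpd.aeval _ he, hqd.aeval _ he, ?_⟩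
  rw [map_sub, pullDiv_divForm Z Φ p hp ⟨d, hpd⟩, pullDiv_divForm Z Φ q hq ⟨d, hqd⟩]
  unfold pullForm
  rw [hpd.totalDegree hp, hqd.totalDegree hq]
  abel

end Descent

/-- The pull-back `Φ^*` on the divisor class group of `Bl_Z ℙ³`. -/
noncomputable def pullback (Z : Finset P3) (Φ : BirMap) : AddMonoid.End (DivClassGroup Z) :=
  QuotientAddGroup.map (principal Z) (principal Z) (pullDiv Z Φ) (principal_le Z Φ)

/-- The push-forward `Φ_* = (Φ⁻¹)^*` on the divisor class group of `Bl_Z ℙ³`. -/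
noncomputable def pushforward (Z : Finset P3) (Φ : BirMap) : AddMonoid.End (DivClassGroup Z) :=
  pullback Z Φ.symm

/-- The class `ε^* H` of the pull-back of a plane of `ℙ³`. -/
noncomputable def planeClass (Z : Finset P3) : DivClassGroup Z :=
  QuotientAddGroup.mk (divForm Z (X 0) (X_ne_zero 0))

/-- The class of the exceptional divisor over a point of the centre `Z`. -/
noncomputable def excClass (Z : Finset P3) (a : P3) (ha : a ∈ Z) : DivClassGroup Z :=
  QuotientAddGroup.mk (Finsupp.single (.exc ⟨a, ha⟩) 1)

/-! ### The Cremona-cubes group -/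

/-- The coordinate points `e₁, …, e₄`. -/
noncomputable def ePt (j : Fin 4) : P3 :=
  Projectivization.mk ℂ (Pi.single j 1) (by simp)

/-- The vectors `(1,-1,-1,-1), (-1,1,-1,-1), (-1,-1,1,-1), (-1,-1,-1,1)`. -/
def pVec : Fin 4 → Fin 4 → ℂ :=
  ![![1, -1, -1, -1], ![-1, 1, -1, -1], ![-1, -1, 1, -1], ![-1, -1, -1, 1]]

/-- The vectors `(1,-1,-1,1), (-1,1,-1,1), (1,1,-1,-1), (1,1,1,1)`. -/
def qVec : Fin 4 → Fin 4 → ℂ :=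
  ![![1, -1, -1, 1], ![-1, 1, -1, 1], ![1, 1, -1, -1], ![1, 1, 1, 1]]

lemma pVec_ne_zero (j : Fin 4) : pVec j ≠ 0 := fun h => by
  have := congrFun h 0
  fin_cases j <;> simp [pVec] at this

lemma qVec_ne_zero (j : Fin 4) : qVec j ≠ 0 := fun h => by
  have := congrFun h 0
  fin_cases j <;> simp [qVec] at this

/-- The fixed points `p₁, …, p₄` of the standard Cremona transformation. -/
noncomputable def pPt (j : Fin 4) : P3 := Projectivization.mk ℂ (pVec j) (pVec_ne_zero j)

/-- The fixed points `q₁, …, q₄` of the standard Cremona transformation. -/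
noncomputable def qPt (j : Fin 4) : P3 := Projectivization.mk ℂ (qVec j) (qVec_ne_zero j)

open Classical in
/-- The set `R` of the twelve points `e_j`, `p_j`, `q_j`. -/
noncomputable def reye : Finset P3 :=
  Finset.univ.image ePt ∪ Finset.univ.image pPt ∪ Finset.univ.image qPt

lemma ePt_mem (j : Fin 4) : ePt j ∈ reye := by simp [reye]

lemma pPt_mem (j : Fin 4) : pPt j ∈ reye := by simp [reye]

lemma qPt_mem (j : Fin 4) : qPt j ∈ reye := by simp [reye]

/-- The Cremona-cubes group: the projectivities that map `R` into itself. -/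
def cremonaCubes : Subgroup PGL(4, ℂ) where
  carrier := {γ | ∀ x ∈ reye, γ • x ∈ reye}
  one_mem' := fun x hx => by simpa using hx
  mul_mem' := fun {γ δ} hγ hδ x hx => by
    rw [mul_smul]
    exact hγ _ (hδ x hx)
  inv_mem' := fun {γ} hγ x hx => by
    obtain ⟨y, hy, rfl⟩ := Finset.surj_on_of_inj_on_of_card_le (s := reye) (t := reye)
      (fun y _ => γ • y) hγ (fun _ _ _ _ h => smul_left_cancel γ h) le_rfl x hx
    simpa using hy

/-- The points of `ℙ³` represented by the columns of an invertible matrix. -/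
noncomputable def colPt (A : GL (Fin 4) ℂ) (j : Fin 4) : P3 :=
  Projectivization.mk ℂ (fun i => (A : Matrix (Fin 4) (Fin 4) ℂ) i j) fun h => by
    have hd := Matrix.GeneralLinearGroup.det_ne_zero A
    exact hd (Matrix.det_eq_zero_of_column_eq_zero j fun i => congrFun h i)

/-- The points of `ℙ³` represented by the rows of an invertible matrix. -/
noncomputable def rowPt (A : GL (Fin 4) ℂ) (i : Fin 4) : P3 :=
  Projectivization.mk ℂ (fun j => (A : Matrix (Fin 4) (Fin 4) ℂ) i j) fun h => by
    have hd := Matrix.GeneralLinearGroup.det_ne_zero A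
    exact hd (Matrix.det_eq_zero_of_row_eq_zero i fun j => congrFun h j)

/-- The columns of `A` represent the points `p₁, …, p₄` and its rows the points `q₁, …, q₄`. -/
def ColsPRowsQ (A : GL (Fin 4) ℂ) : Prop :=
  Set.range (colPt A) = Set.range pPt ∧ Set.range (rowPt A) = Set.range qPt

/-- The columns of `A` represent the points `q₁, …, q₄` and its rows the points `p₁, …, p₄`. -/
def ColsQRowsP (A : GL (Fin 4) ℂ) : Prop :=
  Set.range (colPt A) = Set.range qPt ∧ Set.range (rowPt A) = Set.range pPt

/-- The projectivity represented by the matrix `A` is an element of the Cremona-cubes group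
of type (C). -/
def IsTypeC (A : GL (Fin 4) ℂ) : Prop :=
  Matrix.ProjGenLinGroup.mk A ∈ cremonaCubes ∧ (ColsPRowsQ A ∨ ColsQRowsP A)

end CremonaCubes

open CremonaCubes

/-!
Write `Φ = g ∘ C₃`, let `e_j`, `u_j`, `v_j` be the twelve points, named so that `g` maps
`{e_j} → {u_j} → {v_j} → {e_j}`; that a projectivity of type (C) does so follows from its columns
being the `u_j` and its rows the pairwise orthogonal `v_j` (`IsReye.exists_perm`). The map `C₃`
contracts the plane `x_j = 0` to `e_j`, blows `e_j` up to that plane, and is a local isomorphism at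
its fixed points, among which are the `u_j` and `v_j`. For a form `p` of degree `d` this is stated
by three identities for the orders of vanishing of `p ∘ C₃`: the exponent of `x_j` in `p ∘ C₃` is
the multiplicity of `p` at `e_j` (`emultiplicity_aeval_cremona`), the multiplicity of `p ∘ C₃` at
`e_j` is `2 d` plus the exponent of `x_j` in `p` (`ordAt_eVec_aeval_cremona`), and the
multiplicities at `u_j` and `v_j` do not change (`ordAt_aeval_cremona_of_sq`). Everything else rests
on them.

*Degrees.* Let `V` be a vector of forms of degree `d` without common factor, whose generic
multiplicities at the points `e_j`, `u_j`, `v_j` are `x`, `y`, `z`. Then `V ∘ g ∘ C₃` has the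
greatest common divisor `(x₁ x₂ x₃ x₄) ^ y`: a coordinate plane divides it to the order `y`, and
another common component would have an image under `g ∘ C₃` that is a common component of `V`.
After division the degree is `3 d - 4 y` and the multiplicities are `2 d - 3 y`, `z`, `x`
(`IsReduced.step`). Starting from the identity this is the recurrence, with `b_n`, `f_n`, `c_n` as
the multiplicities at the points `e_j`, `u_j`, `v_j`, whence `degree_iterate`.

*Class group.* Degree and multiplicities define a homomorphism on divisors that kills the principal
ones, which gives the independence of the classes; `divForm_surface` gives their generation.

*Push-forward.* The order along a prime divisor `D` of a composite with `Φ⁻¹ = C₃ ∘ g⁻¹` is given by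
the same identities: `D` is mapped to the exceptional divisor over `e_j` if it is the plane
`g(x_j = 0)`, to the plane `x_m = 0` if it lies over `g(e_m)`, to the exceptional divisor over `w` if
it lies over `g(w)` with `w` one of the `u_j`, `v_j`, and to another surface otherwise. Hence `Φ_*`
maps `E_{e_k}` to the strict transform of `g(x_k = 0)` and `E_w` to `E_{g(w)}`, and the fixed part of
`Φ⁻¹` is `2 ∑ E_{u_j}`. On the span of `H`, `∑ E_{e_j}`, `∑ E_{u_j}`, `∑ E_{v_j}` the recurrence is
iteration of the resulting matrix.

*Growth.* The closed formula is checked by induction together with those for `f_n`, `b_n`, `c_n`;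
it shows that `d_n / φ ^ (2 n)` tends to `8 / 5`, which gives the entropy.
-/

namespace CremonaCubes

/-! ### Orders of vanishing at points -/

lemma natCast_le_order_iff (p : Poly) (n : ℕ) :
    (n : ℕ∞) ≤ (p : MvPowerSeries (Fin 4) ℂ).order ↔ p ∈ idealOfVars (Fin 4) ℂ ^ n := by
  rw [mem_pow_idealOfVars_iff']
  refine ⟨fun h m hm => ?_, fun h => MvPowerSeries.nat_le_order fun m hm => ?_⟩
  · rw [← coeff_coe]
    exact MvPowerSeries.coeff_of_lt_order (lt_of_lt_of_le (by exact_mod_cast hm) h)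
  · rw [coeff_coe]
    exact h m hm

lemma mem_idealOfVars_iff (p : Poly) : p ∈ idealOfVars (Fin 4) ℂ ↔ coeff 0 p = 0 := by
  rw [← pow_one (idealOfVars (Fin 4) ℂ), mem_pow_idealOfVars_iff']
  refine ⟨fun h => h 0 (by simp), fun h m hm => ?_⟩
  rw [(Finsupp.degree_eq_zero_iff m).mp (by omega), h]

/-- Substituting polynomials without constant term does not lower the order at the origin. -/
lemma order_le_order_aeval (p : Poly) (g : Fin 4 → Poly) (hg : ∀ i, coeff 0 (g i) = 0) :
    (p : MvPowerSeries (Fin 4) ℂ).order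
      ≤ ((aeval g p : Poly) : MvPowerSeries (Fin 4) ℂ).order := by
  refine ENat.forall_natCast_le_iff_le.mp fun n hn => ?_
  rw [natCast_le_order_iff] at hn ⊢
  have h1 : (idealOfVars (Fin 4) ℂ).map (aeval g : Poly →ₐ[ℂ] Poly) ≤ idealOfVars (Fin 4) ℂ := by
    rw [idealOfVars, Ideal.map_span, Ideal.span_le]
    rintro _ ⟨_, ⟨i, rfl⟩, rfl⟩
    simpa [mem_idealOfVars_iff] using hg i
  have h2 := Ideal.mem_map_of_mem (aeval g : Poly →ₐ[ℂ] Poly) hn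
  rw [Ideal.map_pow] at h2
  exact Ideal.pow_right_mono h1 n h2

lemma aeval_aeval (G F : Fin 4 → Poly) (p : Poly) :
    (aeval G (aeval F p : Poly) : Poly) = aeval (fun i => (aeval G (F i) : Poly)) p := by
  rw [← AlgHom.comp_apply]
  refine congrArg (fun f : Poly →ₐ[ℂ] Poly => f p) (algHom_ext fun i => ?_)
  rw [AlgHom.comp_apply, aeval_X, aeval_X]

lemma eval_aeval (v : Fin 4 → ℂ) (F : Fin 4 → Poly) (p : Poly) :
    eval v (aeval F p : Poly) = eval (fun i => eval v (F i)) p := by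
  rw [← coe_aeval_eq_eval, ← coe_aeval_eq_eval, RingHom.coe_coe, RingHom.coe_coe,
    ← AlgHom.comp_apply]
  refine congrArg (fun f : Poly →ₐ[ℂ] ℂ => f p) (algHom_ext fun i => ?_)
  rw [AlgHom.comp_apply, aeval_X, aeval_X]

lemma coeff_zero_taylor (v : Fin 4 → ℂ) (p : Poly) :
    coeff 0 (aeval (fun i => X i + C (v i)) p : Poly) = eval v p := by
  have h : ∀ q : Poly, coeff 0 q = eval 0 q := fun q => by
    rw [← constantCoeff_eq, ← eval_zero]
  rw [h, eval_aeval]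
  congr 2
  ext i
  simp

lemma one_le_ordAt_iff (v : Fin 4 → ℂ) (p : Poly) : 1 ≤ ordAt v p ↔ eval v p = 0 := by
  rw [ordAt, ← Nat.cast_one, natCast_le_order_iff, pow_one, mem_idealOfVars_iff, coeff_zero_taylor]

lemma ordAt_eq_zero_iff (v : Fin 4 → ℂ) (p : Poly) : ordAt v p = 0 ↔ eval v p ≠ 0 := by
  rw [Ne, ← one_le_ordAt_iff, Order.one_le_iff_ne_zero, not_not]

lemma min_ordAt_le_add (v : Fin 4 → ℂ) (p q : Poly) :
    min (ordAt v p) (ordAt v q) ≤ ordAt v (p + q) := by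
  simpa [ordAt, -aeval_eq_bind₁] using MvPowerSeries.min_order_le_add
    (f := ((aeval (fun i => X i + C (v i)) p : Poly) : MvPowerSeries (Fin 4) ℂ))
    (g := ((aeval (fun i => X i + C (v i)) q : Poly) : MvPowerSeries (Fin 4) ℂ))

lemma ordAt_zero (v : Fin 4 → ℂ) : ordAt v 0 = ⊤ := by simp [ordAt]

lemma ordAt_one (v : Fin 4 → ℂ) : ordAt v 1 = 0 := by simp [ordAt_eq_zero_iff]

lemma ordAt_pow (v : Fin 4 → ℂ) (p : Poly) (n : ℕ) : ordAt v (p ^ n) = n * ordAt v p := by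
  induction n with
  | zero => simp [ordAt_one]
  | succ n ih => rw [pow_succ, ordAt_mul, ih]; push_cast; ring

lemma ordAt_prod (v : Fin 4 → ℂ) {ι : Type*} (s : Finset ι) (f : ι → Poly) :
    ordAt v (∏ i ∈ s, f i) = ∑ i ∈ s, ordAt v (f i) := by
  classical
  induction s using Finset.induction_on with
  | empty => simp [ordAt_one]
  | insert a s ha ih => rw [Finset.prod_insert ha, Finset.sum_insert ha, ordAt_mul, ih]

lemma ordAt_C_mul (v : Fin 4 → ℂ) {c : ℂ} (hc : c ≠ 0) (p : Poly) :
    ordAt v (C c * p) = ordAt v p := by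
  rw [ordAt_mul, (ordAt_eq_zero_iff v (C c)).mpr (by simpa using hc), zero_add]

lemma le_ordAt_sum (v : Fin 4 → ℂ) {ι : Type*} (s : Finset ι) (f : ι → Poly) (n : ℕ∞)
    (h : ∀ i ∈ s, n ≤ ordAt v (f i)) : n ≤ ordAt v (∑ i ∈ s, f i) := by
  classical
  induction s using Finset.induction_on with
  | empty => simp [ordAt_zero]
  | insert a s ha ih =>
    rw [Finset.sum_insert ha]
    exact (le_min (h a (by simp)) (ih fun i hi => h i (by simp [hi]))).trans
      (min_ordAt_le_add _ _ _)

/-- A polynomial map does not lower orders of vanishing. -/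
lemma ordAt_le_ordAt_aeval (v : Fin 4 → ℂ) (F : Fin 4 → Poly) (p : Poly) :
    ordAt (fun i => eval v (F i)) p ≤ ordAt v (aeval F p) := by
  have h := order_le_order_aeval (aeval (fun i => X i + C (eval v (F i))) p : Poly)
    (fun i => aeval (fun i => X i + C (v i)) (F i) - C (eval v (F i)))
    (fun i => by rw [coeff_sub, coeff_zero_taylor]; simp)
  rw [ordAt, ordAt]
  refine h.trans_eq (congrArg (fun q : Poly => (q : MvPowerSeries (Fin 4) ℂ).order) ?_)
  rw [aeval_aeval, aeval_aeval]
  refine congrArg (fun f : Poly →ₐ[ℂ] Poly => f p) (algHom_ext fun i => ?_)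
  simp

lemma ordAt_le_ordAt_smul (v : Fin 4 → ℂ) {c : ℂ} (hc : c ≠ 0) {p : Poly} {d : ℕ}
    (hp : p.IsHomogeneous d) : ordAt (c • v) p ≤ ordAt v p := by
  have h := ordAt_le_ordAt_aeval v (fun i => C c * X i) p
  rw [BirMap.aeval_mul_X hp, ← C_pow, ordAt_C_mul _ (pow_ne_zero _ hc)] at h
  refine le_trans (le_of_eq ?_) h
  congr 1
  ext i
  simp

lemma ordAt_smul (v : Fin 4 → ℂ) {c : ℂ} (hc : c ≠ 0) {p : Poly} {d : ℕ}
    (hp : p.IsHomogeneous d) : ordAt (c • v) p = ordAt v p := by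
  refine le_antisymm (ordAt_le_ordAt_smul v hc hp) ?_
  have h := ordAt_le_ordAt_smul (c • v) (inv_ne_zero hc) hp
  rwa [smul_smul, inv_mul_cancel₀ hc, one_smul] at h

/-- A vector of forms whose composite with a second one is `x ↦ κ(x) x` is a local isomorphism
where `κ` does not vanish, hence preserves orders of vanishing there. -/
lemma ordAt_aeval_eq {F G : Fin 4 → Poly} {κ : Poly} (hκ : ∀ i, aeval F (G i) = κ * X i)
    (hκ' : ∀ i, aeval G (F i) = κ * X i) {e : ℕ} (he : ∀ i, (F i).IsHomogeneous e)
    {v : Fin 4 → ℂ} (hv : eval v κ ≠ 0) (hv' : eval (fun i => eval v (F i)) κ ≠ 0)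
    {p : Poly} {d : ℕ} (hp : p.IsHomogeneous d) :
    ordAt v (aeval F p) = ordAt (fun i => eval v (F i)) p := by
  refine le_antisymm ?_ (ordAt_le_ordAt_aeval v F p)
  have h := ordAt_le_ordAt_aeval (fun i => eval v (F i)) G (aeval F p)
  have h1 : aeval G (aeval F p) = κ ^ d * p := by
    rw [← BirMap.aeval_mul_X hp, aeval_aeval]
    simp only [hκ']
  have h2 : (fun i => eval (fun i => eval v (F i)) (G i)) = eval v κ • v := by
    ext i
    have := congrArg (eval v) (hκ i)
    rwa [map_mul, eval_X, eval_aeval] at this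
  rw [h1, h2, ordAt_smul v hv (hp.aeval F he), ordAt_mul, ordAt_pow,
    (ordAt_eq_zero_iff _ κ).mpr hv', mul_zero, zero_add] at h
  exact h

/-! ### Linear forms -/

lemma eval_linForm (l v : Fin 4 → ℂ) : eval v (linForm l) = ∑ i, l i * v i := by
  simp [linForm]

lemma linForm_injective : Function.Injective linForm := by
  intro l l' h
  ext i
  have := congrArg (eval (Pi.single i 1 : Fin 4 → ℂ)) h
  simpa [eval_linForm, Pi.single_apply] using this

lemma linForm_zero : linForm 0 = 0 := by simp [linForm]

lemma linForm_ne_zero {l : Fin 4 → ℂ} (hl : l ≠ 0) : linForm l ≠ 0 :=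
  fun h => hl (linForm_injective (h.trans linForm_zero.symm))

lemma ordAt_linForm {l v : Fin 4 → ℂ} (hl : l ≠ 0) (h : ∑ i, l i * v i = 0) :
    ordAt v (linForm l) = 1 := by
  refine le_antisymm ?_ ((one_le_ordAt_iff _ _).mpr (by rw [eval_linForm, h]))
  obtain ⟨i, hi⟩ := Function.ne_iff.mp hl
  rw [ordAt]
  refine (MvPowerSeries.order_le (d := Finsupp.single i 1) ?_).trans (by simp)
  rw [coeff_coe]
  have : (aeval (fun i => X i + C (v i)) (linForm l) : Poly) = linForm l := by
    have h2 : ∑ i, (C (l i) * C (v i) : Poly) = 0 := by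
      simp only [← C_mul, ← map_sum, h, map_zero]
    simp only [linForm, map_sum, map_mul, aeval_X, algHom_C, algebraMap_eq, mul_add,
      Finset.sum_add_distrib, h2, add_zero]
  rw [this, linForm, coeff_sum, Finset.sum_eq_single i]
  · simpa [coeff_C_mul] using hi
  · intro j _ hj
    rw [coeff_C_mul, coeff_X, if_neg, mul_zero]
    rwa [Finsupp.single_left_inj one_ne_zero]
  · simp

lemma ordAt_linForm_of_ne {l v : Fin 4 → ℂ} (h : ∑ i, l i * v i ≠ 0) :
    ordAt v (linForm l) = 0 := by
  rwa [ordAt_eq_zero_iff, eval_linForm]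

lemma isUnit_of_totalDegree_eq_zero {p : Poly} (hp : p ≠ 0) (h : p.totalDegree = 0) :
    IsUnit p := by
  rw [totalDegree_eq_zero_iff_eq_C.mp h] at hp ⊢
  exact (IsUnit.mk0 _ fun h0 => hp (by rw [h0, map_zero])).map C

/-- Two planes with a common component coincide. -/
lemma exists_smul_of_dvd_linForm {s : Poly} (hs : ¬ IsUnit s) {l l' : Fin 4 → ℂ} (hl : l ≠ 0)
    (h : s ∣ linForm l) (h' : s ∣ linForm l') : ∃ c : ℂ, l' = c • l := by
  have key : ∀ (m : Fin 4 → ℂ), s ∣ linForm m → ∃ c : ℂ, linForm m = C c * s := by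
    rintro m ⟨t, ht⟩
    rcases eq_or_ne m 0 with rfl | hm
    · exact ⟨0, by simp [linForm_zero]⟩
    have h0 := linForm_ne_zero hm
    have hd := (linForm_hom m).totalDegree h0
    rw [ht] at h0 hd
    have hs0 := left_ne_zero_of_mul h0
    rw [totalDegree_mul_of_isDomain hs0 (right_ne_zero_of_mul h0)] at hd
    have : s.totalDegree ≠ 0 := fun h1 => hs (isUnit_of_totalDegree_eq_zero hs0 h1)
    refine ⟨coeff 0 t, ?_⟩
    rw [ht, ← totalDegree_eq_zero_iff_eq_C.mp (by omega : t.totalDegree = 0), mul_comm]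
  obtain ⟨c, hc⟩ := key l h
  obtain ⟨c', hc'⟩ := key l' h'
  have hc0 : c ≠ 0 := by
    rintro rfl
    exact linForm_ne_zero hl (by rw [hc, map_zero, zero_mul])
  refine ⟨c' / c, linForm_injective ?_⟩
  have : linForm ((c' / c) • l) = C (c' / c) * linForm l := by
    simp only [linForm, Finset.mul_sum, ← mul_assoc, ← C_mul, Pi.smul_apply, smul_eq_mul]
  rw [this, hc, hc', ← mul_assoc, ← C_mul, div_mul_cancel₀ _ hc0]

/-! ### Multiplicities under the standard Cremona transformation -/

/-- The equation `x₁ x₂ x₃ x₄` of the coordinate tetrahedron. -/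
noncomputable def coordProd : Poly := ∏ j, X j

lemma coordProd_ne_zero : coordProd ≠ 0 := Finset.prod_ne_zero_iff.mpr fun j _ => X_ne_zero j

lemma X_dvd_coordProd (j : Fin 4) : X j ∣ coordProd := Finset.dvd_prod_of_mem _ (Finset.mem_univ j)

lemma coordProd_hom : coordProd.IsHomogeneous 4 := by
  simpa [coordProd] using IsHomogeneous.prod Finset.univ (fun j : Fin 4 => (X j : Poly)) (fun _ => 1)
    fun j _ => isHomogeneous_X ℂ j

lemma eval_coordProd (v : Fin 4 → ℂ) : eval v coordProd = ∏ j, v j := by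
  simp [coordProd]

lemma cremona_mul_X (i : Fin 4) : cremona.toFun i * X i = coordProd :=
  Finset.prod_erase_mul _ _ (Finset.mem_univ i)

lemma cremona_hom (i : Fin 4) : (cremona.toFun i).IsHomogeneous 3 := by
  simpa [cremona] using IsHomogeneous.prod (Finset.univ.erase i) (fun j => (X j : Poly)) (fun _ => 1)
    fun j _ => isHomogeneous_X ℂ j

lemma aeval_cremona_coordProd : aeval cremona.toFun coordProd = coordProd ^ 3 := by
  refine mul_right_cancel₀ coordProd_ne_zero ?_
  conv_lhs => rw [coordProd]
  rw [map_prod]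
  simp only [aeval_X]
  rw [← Finset.prod_mul_distrib]
  simp only [cremona_mul_X]
  simp
  ring

lemma aeval_cremona_cremona (i : Fin 4) :
    aeval cremona.toFun (cremona.toFun i) = coordProd ^ 2 * X i := by
  have h := congrArg (aeval cremona.toFun : Poly →ₐ[ℂ] Poly) (cremona_mul_X i)
  rw [map_mul, aeval_X, aeval_cremona_coordProd] at h
  have h0 : cremona.toFun i ≠ 0 :=
    left_ne_zero_of_mul ((cremona_mul_X i).symm ▸ coordProd_ne_zero)
  refine mul_right_cancel₀ h0 (h.trans ?_)
  rw [mul_assoc, mul_comm (X i), cremona_mul_X]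
  ring

lemma aeval_cremona_aeval_cremona {p : Poly} {d : ℕ} (hp : p.IsHomogeneous d) :
    aeval cremona.toFun (aeval cremona.toFun p : Poly) = (coordProd ^ 2) ^ d * p := by
  rw [aeval_aeval, ← BirMap.aeval_mul_X hp]
  simp only [aeval_cremona_cremona]

lemma X_dvd_cremona {i j : Fin 4} (h : i ≠ j) : X j ∣ cremona.toFun i :=
  Finset.dvd_prod_of_mem X (Finset.mem_erase.mpr ⟨h.symm, Finset.mem_univ j⟩)

/-- The vector representing the `j`-th coordinate point. -/
noncomputable abbrev eVec (j : Fin 4) : Fin 4 → ℂ := Pi.single j 1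

lemma ordAt_eVec_X_of_ne {i j : Fin 4} (h : i ≠ j) : ordAt (eVec j) (X i) = 1 := by
  have : (X i : Poly) = linForm (Pi.single i 1) := by simp [linForm, Pi.single_apply]
  rw [this, ordAt_linForm (by simp)]
  simp [Pi.single_apply, h.symm]

lemma ordAt_eVec_X_self (j : Fin 4) : ordAt (eVec j) (X j) = 0 := by
  simp [ordAt_eq_zero_iff]

lemma ordAt_eVec_coordProd (j : Fin 4) : ordAt (eVec j) coordProd = 3 := by
  rw [coordProd, ordAt_prod, ← Finset.add_sum_erase _ _ (Finset.mem_univ j), ordAt_eVec_X_self,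
    Finset.sum_congr rfl fun i hi => ordAt_eVec_X_of_ne (Finset.ne_of_mem_erase hi)]
  simp

lemma two_le_ordAt_eVec_cremona (i j : Fin 4) : 2 ≤ ordAt (eVec j) (cremona.toFun i) := by
  have h := congrArg (ordAt (eVec j)) (cremona_mul_X i)
  rw [ordAt_mul, ordAt_eVec_coordProd] at h
  have h1 : ordAt (eVec j) (X i) ≤ 1 := by
    rcases eq_or_ne i j with rfl | hij
    · simp [ordAt_eVec_X_self]
    · exact (ordAt_eVec_X_of_ne hij).le
  generalize ordAt (eVec j) (cremona.toFun i) = a at *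
  generalize ordAt (eVec j) (X i) = b at *
  lift b to ℕ using ne_top_of_le_ne_top (by simp) h1
  induction a with
  | top => exact le_top
  | coe a => norm_cast at *; omega

lemma le_ordAt_aeval_of_le {v : Fin 4 → ℂ} {F : Fin 4 → Poly} {r : ℕ}
    (hF : ∀ i, (r : ℕ∞) ≤ ordAt v (F i)) {p : Poly} {d : ℕ} (hp : p.IsHomogeneous d) :
    ((d * r : ℕ) : ℕ∞) ≤ ordAt v (aeval F p) := by
  rw [aeval_def, eval₂_eq']
  refine le_ordAt_sum _ _ _ _ fun m hm => ?_
  rw [ordAt_mul, ordAt_prod]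
  refine le_trans ?_ le_add_self
  have hd : m.degree = d := by
    by_contra h
    exact (mem_support_iff.mp hm) (hp.coeff_eq_zero h)
  rw [← hd, Finsupp.degree_eq_sum, Finset.sum_mul, Nat.cast_sum]
  refine Finset.sum_le_sum fun i _ => ?_
  rw [ordAt_pow]
  push_cast
  exact mul_le_mul_right (hF i) _

/-- The multiplicity of a form of degree `d` at the coordinate point `e_j` is at most `d - m_j` for
each of its monomials `x^m`. -/
lemma ordAt_eVec_add_le {p : Poly} {d : ℕ} (hp : p.IsHomogeneous d) (j : Fin 4) {m : Fin 4 →₀ ℕ}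
    (hm : m ∈ p.support) : ordAt (eVec j) p + m j ≤ d := by
  -- in the affine chart `x_j = 1` distinct monomials of `p` remain distinct
  have h := order_le_order_aeval (aeval (fun i => X i + C (eVec j i)) p : Poly)
    (fun i => if i = j then 0 else X i) (fun i => by split_ifs <;> simp)
  rw [aeval_aeval] at h
  have hg : (fun i => (aeval (fun i => if i = j then 0 else X i : Fin 4 → Poly)
      (X i + C (eVec j i) : Poly) : Poly)) = fun i => if i = j then 1 else X i := by
    ext1 i
    rcases eq_or_ne i j with rfl | hij
    · simp
    · simp [hij]
  rw [hg] at h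
  have hmon : ∀ n : Fin 4 →₀ ℕ, ∏ i, (if i = j then 1 else X i : Poly) ^ n i
      = monomial (n.erase j) 1 := by
    intro n
    rw [monomial_eq, Finsupp.prod_fintype _ _ (fun _ => pow_zero _), C_1, one_mul]
    refine Finset.prod_congr rfl fun i _ => ?_
    rcases eq_or_ne i j with rfl | hij
    · simp
    · simp [hij]
  have hdeg : ∀ n ∈ p.support, n.degree = d := fun n hn => by
    by_contra h
    exact (mem_support_iff.mp hn) (hp.coeff_eq_zero h)
  have herase : ∀ n : Fin 4 →₀ ℕ, (n.erase j).degree + n j = n.degree := fun n => by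
    conv_rhs => rw [← Finsupp.erase_add_single j n, map_add, Finsupp.degree_single]
  have hcoeff : coeff (m.erase j) (aeval (fun i => if i = j then 1 else X i : Fin 4 → Poly) p
      : Poly) = coeff m p := by
    rw [aeval_def, eval₂_eq', coeff_sum, Finset.sum_eq_single m]
    · rw [hmon, algebraMap_eq, coeff_C_mul, coeff_monomial, if_pos rfl, mul_one]
    · intro n hn hnm
      rw [hmon, algebraMap_eq, coeff_C_mul, coeff_monomial, if_neg, mul_zero]
      intro he
      apply hnm
      have h1 := herase n
      have h2 := herase m
      rw [he, hdeg n hn] at h1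
      rw [hdeg m hm] at h2
      rw [← Finsupp.erase_add_single j n, ← Finsupp.erase_add_single j m, he,
        show n j = m j by omega]
    · exact fun h => absurd hm h
  have h3 := h.trans (MvPowerSeries.order_le (d := m.erase j)
    (by rw [coeff_coe, hcoeff]; exact mem_support_iff.mp hm))
  calc ordAt (eVec j) p + m j ≤ (m.erase j).degree + m j := by gcongr; exact h3
    _ = d := by rw [← hdeg m hm, ← herase m]; push_cast; rfl

lemma X_pow_dvd_aeval_cremona {p : Poly} {d : ℕ} (hp : p.IsHomogeneous d) (j : Fin 4) {n : ℕ}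
    (hn : (n : ℕ∞) ≤ ordAt (eVec j) p) : X j ^ n ∣ aeval cremona.toFun p := by
  rw [aeval_def, eval₂_eq']
  refine Finset.dvd_sum fun m hm => Dvd.dvd.mul_left ?_ _
  have hd : m.degree = d := by
    by_contra h
    exact (mem_support_iff.mp hm) (hp.coeff_eq_zero h)
  have h1 : n + m j ≤ d := by
    have := (add_le_add_left hn _).trans (ordAt_eVec_add_le hp j hm)
    exact_mod_cast this
  rw [← hd, Finsupp.degree_eq_sum, ← Finset.sum_erase_add _ _ (Finset.mem_univ j)] at h1
  rw [← Finset.prod_erase_mul _ _ (Finset.mem_univ j)]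
  refine Dvd.dvd.mul_right ((pow_dvd_pow (X j) (by omega :
    n ≤ ∑ i ∈ Finset.univ.erase j, m i)).trans ?_) _
  rw [← Finset.prod_pow_eq_pow_sum]
  exact Finset.prod_dvd_prod_of_dvd _ _ fun i hi =>
    pow_dvd_pow_of_dvd (X_dvd_cremona (Finset.ne_of_mem_erase hi)) _

/-- Converse of `X_pow_dvd_aeval_cremona`: if the exponent of `x_j` in `p ∘ C₃ = x_j ^ k q` is large,
then so is the multiplicity at `e_j` of `p ∘ C₃ ∘ C₃`, because `C₃` has multiplicity `2` there. -/
lemma le_ordAt_of_X_pow_dvd {p : Poly} {d : ℕ} (hp : p.IsHomogeneous d) (j : Fin 4) {k : ℕ}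
    (hk : X j ^ k ∣ aeval cremona.toFun p) : (k : ℕ∞) ≤ ordAt (eVec j) p := by
  rcases eq_or_ne p 0 with rfl | hp0
  · simp [ordAt_zero]
  obtain ⟨q, hq⟩ := hk
  have h0 : aeval cremona.toFun p ≠ 0 := cremona.aeval_ne_zero hp hp0
  have hq0 : q ≠ 0 := right_ne_zero_of_mul (hq ▸ h0)
  have hhom := hp.aeval cremona.toFun cremona_hom
  have hqh : q.IsHomogeneous q.totalDegree := by
    refine isHomogeneous_of_mul (q := X j ^ k) (d := 3 * d) ?_ hq0 (pow_ne_zero _ (X_ne_zero j))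
    rwa [mul_comm, ← hq]
  have hdq : k + q.totalDegree = 3 * d := by
    have h1 := ((isHomogeneous_X_pow (R := ℂ) j k).mul hqh).totalDegree (hq ▸ h0)
    rw [← hq, hhom.totalDegree h0] at h1
    exact h1.symm
  -- apply the involution once more and compare orders at `e_j`
  have h2 := aeval_cremona_aeval_cremona hp
  rw [hq, map_mul, map_pow, aeval_X] at h2
  have h3 := congrArg (ordAt (eVec j)) h2
  rw [ordAt_mul, ordAt_mul, ordAt_pow, ordAt_pow, ordAt_pow, ordAt_eVec_coordProd] at h3
  have h4 : ordAt (eVec j) (cremona.toFun j) = 3 := by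
    have := congrArg (ordAt (eVec j)) (cremona_mul_X j)
    rwa [ordAt_mul, ordAt_eVec_coordProd, ordAt_eVec_X_self, add_zero] at this
  have h5 := le_ordAt_aeval_of_le (r := 2) (fun i => two_le_ordAt_eVec_cremona i j) hqh
  rw [h4] at h3
  have hpt := ordAt_ne_top (eVec j) hp0
  generalize ordAt (eVec j) p = a at *
  generalize ordAt (eVec j) (aeval cremona.toFun q) = b at *
  lift a to ℕ using hpt
  induction b with
  | top => exact absurd h3 (by simp only [add_top]; norm_cast)
  | coe b => norm_cast at *; omega

/-- The Cremona transformation contracts the plane `x_j = 0` to `e_j`. -/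
lemma emultiplicity_aeval_cremona {p : Poly} {d : ℕ} (hp : p.IsHomogeneous d) (j : Fin 4) :
    emultiplicity (X j) (aeval cremona.toFun p) = ordAt (eVec j) p := by
  refine le_antisymm ?_ ?_ <;> refine ENat.forall_natCast_le_iff_le.mp fun n hn => ?_
  · exact le_ordAt_of_X_pow_dvd hp j (pow_dvd_of_le_emultiplicity hn)
  · exact le_emultiplicity_of_pow_dvd (X_pow_dvd_aeval_cremona hp j hn)

lemma emultiplicity_X_coordProd (j : Fin 4) : emultiplicity (X j) coordProd = 1 := by
  rw [coordProd, ← Finset.mul_prod_erase _ _ (Finset.mem_univ j), emultiplicity_mul X_prime,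
    (FiniteMultiplicity.of_not_isUnit X_prime.not_isUnit (X_ne_zero j)).emultiplicity_self,
    emultiplicity_eq_zero.mpr, add_zero]
  rw [Prime.dvd_finsetProd_iff X_prime]
  rintro ⟨i, hi, h⟩
  exact Finset.ne_of_mem_erase hi (X_dvd_X.mp h).symm

/-- The Cremona transformation blows `e_j` up to the plane `x_j = 0`. -/
lemma ordAt_eVec_aeval_cremona {p : Poly} {d : ℕ} (hp : p.IsHomogeneous d) (j : Fin 4) :
    ordAt (eVec j) (aeval cremona.toFun p) = (2 * d : ℕ) + emultiplicity (X j) p := by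
  rw [← emultiplicity_aeval_cremona (hp.aeval cremona.toFun cremona_hom),
    aeval_cremona_aeval_cremona hp, emultiplicity_mul X_prime, ← pow_mul,
    emultiplicity_pow X_prime, emultiplicity_X_coordProd, mul_one]

lemma eval_cremona {u : Fin 4 → ℂ} (hu : ∀ i, u i ^ 2 = 1) :
    (fun i => eval u (cremona.toFun i)) = (∏ j, u j) • u := by
  ext i
  have h := congrArg (eval u) (cremona_mul_X i)
  rw [map_mul, eval_X, eval_coordProd] at h
  rw [Pi.smul_apply, smul_eq_mul, ← h, mul_assoc, ← sq, hu i, mul_one]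

lemma prod_ne_zero_of_sq {u : Fin 4 → ℂ} (hu : ∀ i, u i ^ 2 = 1) : ∏ j, u j ≠ 0 :=
  Finset.prod_ne_zero_iff.mpr fun j _ h => by simpa [h] using hu j

/-- The Cremona transformation is a local isomorphism at its fixed points. -/
lemma ordAt_aeval_cremona_of_sq {u : Fin 4 → ℂ} (hu : ∀ i, u i ^ 2 = 1) {p : Poly} {d : ℕ}
    (hp : p.IsHomogeneous d) : ordAt u (aeval cremona.toFun p) = ordAt u p := by
  have h0 := prod_ne_zero_of_sq hu
  rw [ordAt_aeval_eq (F := cremona.toFun) (G := cremona.toFun) aeval_cremona_cremona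
    aeval_cremona_cremona cremona_hom ?_ ?_ hp, eval_cremona hu, ordAt_smul u h0 hp]
  · rw [map_pow, eval_coordProd]
    exact pow_ne_zero _ h0
  · rw [map_pow, eval_coordProd, eval_cremona hu]
    refine pow_ne_zero _ (Finset.prod_ne_zero_iff.mpr fun j _ => mul_ne_zero h0 fun h => ?_)
    simpa [h] using hu j

/-! ### Projectivities -/

lemma projectivity_toFun (A : GL (Fin 4) ℂ) (i : Fin 4) :
    (projectivity A).toFun i = linForm ((A : Matrix (Fin 4) (Fin 4) ℂ) i) := rfl

lemma projectivity_hom (A : GL (Fin 4) ℂ) (i : Fin 4) :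
    ((projectivity A).toFun i).IsHomogeneous 1 := linForm_hom _

lemma aeval_projectivity_linForm (A : GL (Fin 4) ℂ) (l : Fin 4 → ℂ) :
    aeval (projectivity A).toFun (linForm l)
      = linForm (Matrix.vecMul l (A : Matrix (Fin 4) (Fin 4) ℂ)) := by
  simp only [linForm, map_sum, map_mul, aeval_X, algHom_C, algebraMap_eq, projectivity_toFun,
    Finset.mul_sum, Matrix.vecMul, dotProduct, Finset.sum_mul]
  rw [Finset.sum_comm]
  simp only [mul_assoc]

lemma aeval_projectivity_inv (A : GL (Fin 4) ℂ) (p : Poly) :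
    aeval (projectivity A).toFun (aeval (projectivity A⁻¹).toFun p : Poly) = p := by
  rw [aeval_aeval]
  conv_rhs => rw [← aeval_X_left_apply p]
  congr 2
  ext1 i
  rw [projectivity_toFun, aeval_projectivity_linForm]
  have h : Matrix.vecMul (((A⁻¹ : GL (Fin 4) ℂ) : Matrix (Fin 4) (Fin 4) ℂ) i)
      (A : Matrix (Fin 4) (Fin 4) ℂ) = Pi.single i 1 := by
    have h1 : ((A⁻¹ : GL (Fin 4) ℂ) : Matrix (Fin 4) (Fin 4) ℂ) * A = 1 := by
      rw [← Units.val_mul, inv_mul_cancel, Units.val_one]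
    have h2 := congrFun h1 i
    rw [Matrix.mul_apply_eq_vecMul] at h2
    rw [h2]
    ext k
    simp [Matrix.one_apply, Pi.single_apply, eq_comm]
  rw [h]
  simp [linForm, Pi.single_apply]

lemma aeval_projectivity_inv' (A : GL (Fin 4) ℂ) (p : Poly) :
    aeval (projectivity A⁻¹).toFun (aeval (projectivity A).toFun p : Poly) = p := by
  simpa only [inv_inv] using aeval_projectivity_inv A⁻¹ p

lemma dvd_aeval_projectivity (A : GL (Fin 4) ℂ) {s p : Poly}
    (h : s ∣ aeval (projectivity A).toFun p) : aeval (projectivity A⁻¹).toFun s ∣ p := by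
  have := map_dvd (aeval (projectivity A⁻¹).toFun : Poly →ₐ[ℂ] Poly) h
  rwa [aeval_projectivity_inv'] at this

lemma eval_projectivity (A : GL (Fin 4) ℂ) (v : Fin 4 → ℂ) :
    (fun i => eval v ((projectivity A).toFun i)) = (A : Matrix (Fin 4) (Fin 4) ℂ).mulVec v := by
  ext i
  rw [projectivity_toFun, eval_linForm]
  rfl

lemma ordAt_aeval_projectivity (A : GL (Fin 4) ℂ) (v : Fin 4 → ℂ) (p : Poly) :
    ordAt v (aeval (projectivity A).toFun p)
      = ordAt ((A : Matrix (Fin 4) (Fin 4) ℂ).mulVec v) p := by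
  have key : ∀ (B : GL (Fin 4) ℂ) (w : Fin 4 → ℂ) (q : Poly),
      ordAt ((B : Matrix (Fin 4) (Fin 4) ℂ).mulVec w) q
        ≤ ordAt w (aeval (projectivity B).toFun q) := fun B w q => by
    rw [← eval_projectivity]
    exact ordAt_le_ordAt_aeval _ _ _
  refine le_antisymm ?_ (key A v p)
  have h := key A⁻¹ ((A : Matrix (Fin 4) (Fin 4) ℂ).mulVec v) (aeval (projectivity A).toFun p)
  rw [aeval_projectivity_inv', Matrix.mulVec_mulVec, ← Units.val_mul, inv_mul_cancel,
    Units.val_one, Matrix.one_mulVec] at h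
  exact h

/-! ### Projectivities of type (C) -/

/-- The projectivity of matrix `A` permutes the points cyclically: `{e_j} → {u_j} → {v_j} → {e_j}`,
where the coordinates of the vectors `u_j` and `v_j` are `±1`. -/
structure IsCycle (A : GL (Fin 4) ℂ) (u v : Fin 4 → Fin 4 → ℂ) : Prop where
  sq_u : ∀ j i, u j i ^ 2 = 1
  sq_v : ∀ j i, v j i ^ 2 = 1
  map_e : ∃ σ : Equiv.Perm (Fin 4), ∀ j, ∃ c : ℂ, c ≠ 0 ∧
    (A : Matrix (Fin 4) (Fin 4) ℂ).mulVec (eVec j) = c • u (σ j)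
  map_u : ∃ σ : Equiv.Perm (Fin 4), ∀ j, ∃ c : ℂ, c ≠ 0 ∧
    (A : Matrix (Fin 4) (Fin 4) ℂ).mulVec (u j) = c • v (σ j)
  map_v : ∃ σ : Equiv.Perm (Fin 4), ∀ j, ∃ c : ℂ, c ≠ 0 ∧
    (A : Matrix (Fin 4) (Fin 4) ℂ).mulVec (v j) = c • eVec (σ j)

/-! ### The degrees of the iterates -/

/-- The least order of vanishing at `v` of the polynomials `V i` is `x`. -/
def HasMinOrd (v : Fin 4 → ℂ) (V : Fin 4 → Poly) (x : ℕ) : Prop :=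
  (∀ i, (x : ℕ∞) ≤ ordAt v (V i)) ∧ ∃ i, ordAt v (V i) = x

/-- The `V i` are forms of degree `d` without common factor, and the surfaces of the linear system
they span have generic multiplicities `x`, `y`, `z` at the points `e_j`, `u_j`, `v_j`. -/
structure IsReduced (u v : Fin 4 → Fin 4 → ℂ) (V : Fin 4 → Poly) (d x y z : ℕ) : Prop where
  hom : ∀ i, (V i).IsHomogeneous d
  isUnit : ∀ c, (∀ i, c ∣ V i) → IsUnit c
  ord_e : ∀ j, HasMinOrd (eVec j) V x
  ord_u : ∀ j, HasMinOrd (u j) V y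
  ord_v : ∀ j, HasMinOrd (v j) V z

lemma isReduced_X {u v : Fin 4 → Fin 4 → ℂ} (hu : ∀ j i, u j i ^ 2 = 1)
    (hv : ∀ j i, v j i ^ 2 = 1) : IsReduced u v X 1 0 0 0 := by
  have key : ∀ w : Fin 4 → ℂ, ∀ k, w k ≠ 0 → HasMinOrd w X 0 := fun w k hk =>
    ⟨fun i => by simp, k, by simpa [ordAt_eq_zero_iff] using hk⟩
  refine ⟨fun i => isHomogeneous_X ℂ i, fun c hc => ?_, fun j => key _ j (by simp),
    fun j => key _ 0 fun h => by simpa [h] using hu j 0,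
    fun j => key _ 0 fun h => by simpa [h] using hv j 0⟩
  have h := (X_prime (R := ℂ) (i := (0 : Fin 4))).irreducible.isRelPrime_iff_not_dvd.mpr
    (fun h : (X 0 : Poly) ∣ X 1 => absurd (X_dvd_X.mp h) (by decide))
  exact h (hc 0) (hc 1)

lemma coordProd_pow_dvd {q : Poly} {y : ℕ} (h : ∀ j, X j ^ y ∣ q) : coordProd ^ y ∣ q := by
  rw [coordProd, ← Finset.prod_pow]
  refine Finset.prod_dvd_of_isRelPrime (fun i _ j _ hij => ?_) fun j _ => h j
  exact (X_prime.irreducible.isRelPrime_iff_not_dvd.mpr fun h => hij (X_dvd_X.mp h)).pow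

lemma associated_X_of_dvd_coordProd_pow {s : Poly} (hs : Irreducible s) {n : ℕ}
    (h : s ∣ coordProd ^ n) : ∃ j, Associated s (X j) := by
  obtain ⟨j, -, hj⟩ := (Prime.dvd_finsetProd_iff hs.prime _).mp (hs.prime.dvd_of_dvd_pow h)
  exact ⟨j, hs.associated_of_dvd X_prime.irreducible hj⟩

/-- A polynomial all of whose prime factors divide `m` divides a power of `m`. -/
lemma exists_dvd_pow_of_prime_dvd {T m : Poly} (hT : T ≠ 0)
    (h : ∀ t, Irreducible t → t ∣ T → t ∣ m) : ∃ n, T ∣ m ^ n := by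
  induction T using UniqueFactorizationMonoid.induction_on_prime with
  | h₁ => exact absurd rfl hT
  | h₂ u hu => exact ⟨0, hu.dvd⟩
  | h₃ a p ha hp ih =>
    obtain ⟨n, hn⟩ := ih ha fun t ht hta => h t ht (hta.mul_left p)
    refine ⟨n + 1, ?_⟩
    rw [pow_succ']
    exact mul_dvd_mul (h p hp.irreducible (dvd_mul_right p a)) hn

/-- A surface other than a coordinate plane is not contracted by the Cremona transformation: its
preimage, which is its image as `C₃` is an involution, has a component that is not a coordinate
plane. -/
lemma exists_irreducible_dvd_aeval_cremona {s : Poly} {d : ℕ} (hs : Irreducible s)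
    (hd : s.IsHomogeneous d) (hX : ∀ j, ¬ Associated s (X j)) :
    ∃ t, Irreducible t ∧ t ∣ aeval cremona.toFun s ∧ ¬ t ∣ coordProd := by
  by_contra! h
  obtain ⟨n, hn⟩ := exists_dvd_pow_of_prime_dvd (cremona.aeval_ne_zero hd hs.ne_zero) h
  have h1 := map_dvd (aeval cremona.toFun : Poly →ₐ[ℂ] Poly) hn
  rw [map_pow, aeval_cremona_coordProd, ← pow_mul, aeval_cremona_aeval_cremona hd] at h1
  obtain ⟨j, hj⟩ := associated_X_of_dvd_coordProd_pow hs ((dvd_mul_left _ _).trans h1)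
  exact hX j hj

lemma IsReduced.exists_ne_zero {u v : Fin 4 → Fin 4 → ℂ} {V : Fin 4 → Poly} {d x y z : ℕ}
    (h : IsReduced u v V d x y z) : ∃ i, V i ≠ 0 := by
  by_contra! h0
  exact not_isUnit_zero (h.isUnit 0 fun i => (h0 i).symm.dvd)

/-- Composition of a reduced vector of forms with `C₃` after a projectivity of type (C): exactly the
factor `(x₁ x₂ x₃ x₄)^y` has to be removed. -/
lemma IsReduced.step {A : GL (Fin 4) ℂ} {u v : Fin 4 → Fin 4 → ℂ} (hA : IsCycle A u v)
    {V : Fin 4 → Poly} {d x y z : ℕ} (h : IsReduced u v V d x y z) :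
    ∃ (W : Fin 4 → Poly) (d' x' : ℕ), d' + 4 * y = 3 * d ∧ x' + 3 * y = 2 * d ∧
      IsReduced u v W d' x' z x ∧
      ∀ i, coordProd ^ y * W i = aeval ((projectivity A).comp cremona).toFun (V i) := by
  set T : Fin 4 → Poly := fun i => aeval (projectivity A).toFun (V i) with hT
  have hThom : ∀ i, (T i).IsHomogeneous d := fun i => by
    have := (h.hom i).aeval _ (projectivity_hom A)
    rwa [one_mul] at this
  have hTunit : ∀ c, (∀ i, c ∣ T i) → IsUnit c := fun c hc => by
    have := (h.isUnit _ fun i => dvd_aeval_projectivity A (hc i)).map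
      (aeval (projectivity A).toFun : Poly →ₐ[ℂ] Poly)
    rwa [aeval_projectivity_inv] at this
  have hord : ∀ (w w' : Fin 4 → ℂ) (c : ℂ) (k : ℕ), c ≠ 0 →
      (A : Matrix (Fin 4) (Fin 4) ℂ).mulVec w = c • w' → HasMinOrd w' V k → HasMinOrd w T k := by
    intro w w' c k hc hw hk
    have : ∀ i, ordAt w (T i) = ordAt w' (V i) := fun i => by
      rw [hT, ordAt_aeval_projectivity, hw, ordAt_smul _ hc (h.hom i)]
    simpa only [HasMinOrd, this] using hk
  have hTe : ∀ j, HasMinOrd (eVec j) T y := fun j => by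
    obtain ⟨σ, hσ⟩ := hA.map_e
    obtain ⟨c, hc, hw⟩ := hσ j
    exact hord _ _ c y hc hw (h.ord_u _)
  have hTu : ∀ j, HasMinOrd (u j) T z := fun j => by
    obtain ⟨σ, hσ⟩ := hA.map_u
    obtain ⟨c, hc, hw⟩ := hσ j
    exact hord _ _ c z hc hw (h.ord_v _)
  have hTv : ∀ j, HasMinOrd (v j) T x := fun j => by
    obtain ⟨σ, hσ⟩ := hA.map_v
    obtain ⟨c, hc, hw⟩ := hσ j
    exact hord _ _ c x hc hw (h.ord_e _)
  have hdvd : ∀ i, coordProd ^ y ∣ aeval cremona.toFun (T i) := fun i =>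
    coordProd_pow_dvd fun j => X_pow_dvd_aeval_cremona (hThom i) j ((hTe j).1 i)
  choose W hW using hdvd
  obtain ⟨i₀, hi₀⟩ := h.exists_ne_zero
  have hT0 : T i₀ ≠ 0 := (projectivity A).aeval_ne_zero (h.hom i₀) hi₀
  have hCT0 := cremona.aeval_ne_zero (hThom i₀) hT0
  have hhom : ∀ i, (aeval cremona.toFun (T i) : Poly).IsHomogeneous (3 * d) := fun i =>
    (hThom i).aeval _ cremona_hom
  have hcy : (coordProd ^ y).IsHomogeneous (4 * y) := coordProd_hom.pow y
  have hc0 : coordProd ^ y ≠ 0 := pow_ne_zero _ coordProd_ne_zero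
  have hWhom : ∀ i, W i ≠ 0 → (W i).IsHomogeneous (W i).totalDegree ∧
      4 * y + (W i).totalDegree = 3 * d := by
    intro i hi
    have h1 : (W i).IsHomogeneous (W i).totalDegree :=
      isHomogeneous_of_mul (q := coordProd ^ y) (d := 3 * d)
        (by rw [mul_comm, ← hW i]; exact hhom i) hi hc0
    have h2 := hcy.mul h1
    rw [← hW i] at h2
    have h3 : aeval cremona.toFun (T i) ≠ 0 := by
      rw [hW i]
      exact mul_ne_zero hc0 hi
    exact ⟨h1, h2.inj_right (hhom i) h3⟩
  have hW0 : W i₀ ≠ 0 := right_ne_zero_of_mul ((hW i₀) ▸ hCT0)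
  have hd' := (hWhom i₀ hW0).2
  have horde : ∀ j i, (3 * y : ℕ) + ordAt (eVec j) (W i)
      = (2 * d : ℕ) + emultiplicity (X j) (T i) := fun j i => by
    have h1 := congrArg (ordAt (eVec j)) (hW i)
    rw [ordAt_mul, ordAt_pow, ordAt_eVec_coordProd, ordAt_eVec_aeval_cremona (hThom i)] at h1
    rw [h1]
    push_cast
    rw [mul_comm (3 : ℕ∞)]
  have hnd : ∀ j, ∃ i, emultiplicity (X j) (T i) = 0 := fun j => by
    by_contra! hj
    refine X_prime.not_isUnit (hTunit (X j) fun i => ?_)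
    by_contra hi
    exact hj i (emultiplicity_eq_zero.mpr hi)
  have hxy : 3 * y ≤ 2 * d := by
    obtain ⟨i, hi⟩ := hnd 0
    have := horde 0 i
    rw [hi, add_zero] at this
    exact_mod_cast this ▸ le_self_add
  refine ⟨W, (W i₀).totalDegree, 2 * d - 3 * y, by omega, by omega, ?_, fun i => ?_⟩
  · have hordw : ∀ (w : Fin 4 → ℂ) (k : ℕ), (∀ i, w i ^ 2 = 1) → HasMinOrd w T k →
        HasMinOrd w W k := by
      intro w k hw hk
      have : ∀ i, ordAt w (W i) = ordAt w (T i) := fun i => by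
        have h1 := congrArg (ordAt w) (hW i)
        have h2 : ordAt w coordProd = 0 := by
          rw [ordAt_eq_zero_iff, eval_coordProd]
          exact prod_ne_zero_of_sq hw
        rw [ordAt_mul, ordAt_pow, h2, mul_zero, zero_add,
          ordAt_aeval_cremona_of_sq hw (hThom i)] at h1
        exact h1.symm
      simpa only [HasMinOrd, this] using hk
    refine ⟨fun i => ?_, fun c hc => ?_, fun j => ⟨fun i => ?_, ?_⟩,
      fun j => hordw _ _ (hA.sq_u j) (hTu j), fun j => hordw _ _ (hA.sq_v j) (hTv j)⟩
    · rcases eq_or_ne (W i) 0 with hi | hi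
      · rw [hi]
        exact isHomogeneous_zero _ _ _
      · have := hWhom i hi
        rw [show (W i₀).totalDegree = (W i).totalDegree by omega]
        exact this.1
    · by_contra hcu
      have hc0' : c ≠ 0 := fun h0 => hW0 (zero_dvd_iff.mp (h0 ▸ hc i₀))
      obtain ⟨s, hs, hsc⟩ := WfDvdMonoid.exists_irreducible_factor hcu hc0'
      have hsW : ∀ i, s ∣ W i := fun i => hsc.trans (hc i)
      have hshom : s.IsHomogeneous s.totalDegree := by
        obtain ⟨r, hr⟩ := hsW i₀
        have := (hWhom i₀ hW0).1
        rw [hr] at this hW0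
        exact isHomogeneous_of_mul this hs.ne_zero (right_ne_zero_of_mul hW0)
      by_cases hX : ∃ j, Associated s (X j)
      · -- a coordinate plane would divide the composite to an order higher than `y`
        obtain ⟨j, hj⟩ := hX
        obtain ⟨i, hi⟩ := (hTe j).2
        have h1 : X j ^ (y + 1) ∣ aeval cremona.toFun (T i) := by
          rw [hW i, pow_succ]
          exact mul_dvd_mul (pow_dvd_pow_of_dvd (X_dvd_coordProd j) y)
            (hj.symm.dvd.trans (hsW i))
        have h2 := le_ordAt_of_X_pow_dvd (hThom i) j h1
        rw [hi] at h2
        have : y + 1 ≤ y := by exact_mod_cast h2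
        omega
      · -- the image of any other common component would be a common component of the `T i`
        push Not at hX
        obtain ⟨t, ht, hts, htc⟩ := exists_irreducible_dvd_aeval_cremona hs hshom hX
        refine ht.not_isUnit (hTunit t fun i => ?_)
        have h1 := map_dvd (aeval cremona.toFun : Poly →ₐ[ℂ] Poly)
          ((hsW i).trans ((dvd_mul_left _ _).trans (hW i).symm.dvd))
        rw [aeval_cremona_aeval_cremona (hThom i)] at h1
        refine (ht.prime.dvd_or_dvd (hts.trans h1)).resolve_left fun h2 => htc ?_
        exact ht.prime.dvd_of_dvd_pow (ht.prime.dvd_of_dvd_pow h2)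
    · have h1 := horde j i
      generalize ordAt (eVec j) (W i) = a at *
      induction a with
      | top => exact le_top
      | coe a =>
        have h2 : ((2 * d : ℕ) : ℕ∞) ≤ (3 * y : ℕ) + (a : ℕ∞) := h1 ▸ le_self_add
        have h3 : 2 * d ≤ 3 * y + a := by exact_mod_cast h2
        exact_mod_cast (by omega : 2 * d - 3 * y ≤ a)
    · obtain ⟨i, hi⟩ := hnd j
      refine ⟨i, ?_⟩
      have h1 := horde j i
      rw [hi, add_zero] at h1
      generalize ordAt (eVec j) (W i) = a at *
      induction a with
      | top => exact absurd h1 (by simp only [add_top]; norm_cast)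
      | coe a =>
        have h3 : 3 * y + a = 2 * d := by exact_mod_cast h1
        exact_mod_cast (by omega : a = 2 * d - 3 * y)
  · rw [← hW i, hT, aeval_aeval]
    rfl

lemma BirMap.iterate_succ_toFun (Φ : BirMap) (n : ℕ) (i : Fin 4) :
    (Φ.iterate (n + 1)).toFun i = aeval Φ.toFun ((Φ.iterate n).toFun i) := by
  induction n generalizing i with
  | zero =>
    change aeval X (Φ.toFun i) = aeval Φ.toFun (X i)
    rw [aeval_X_left_apply, aeval_X]
  | succ n ih =>
    change aeval (Φ.iterate (n + 1)).toFun (Φ.toFun i)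
      = aeval Φ.toFun (aeval (Φ.iterate n).toFun (Φ.toFun i))
    rw [aeval_aeval]
    congr 2
    ext1 j
    exact ih j

/-- A polynomial that divides all `b * V i`, the `V i` having no common factor, divides `b`. -/
lemma dvd_of_forall_dvd_mul {a b : Poly} {V : Fin 4 → Poly} (ha : a ≠ 0)
    (hV : ∀ c, (∀ i, c ∣ V i) → IsUnit c) (h : ∀ i, a ∣ b * V i) : a ∣ b := by
  induction a using UniqueFactorizationMonoid.induction_on_prime generalizing b with
  | h₁ => exact absurd rfl ha
  | h₂ u hu => exact hu.dvd
  | h₃ a p ha' hp ih =>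
    have hpb : p ∣ b := by
      by_contra hpb
      exact hp.not_isUnit (hV p fun i =>
        (hp.dvd_or_dvd ((dvd_mul_right p a).trans (h i))).resolve_left hpb)
    obtain ⟨b, rfl⟩ := hpb
    refine mul_dvd_mul_left p (ih ha' fun i => ?_)
    have := h i
    rw [mul_assoc] at this
    exact (mul_dvd_mul_iff_left hp.ne_zero).mp this

/-- The degree of a birational map is read off from any vector of forms without common factor that
is proportional to it. -/
lemma BirMap.degree_eq {Φ : BirMap} {V : Fin 4 → Poly} {d : ℕ} {K : Poly}
    (hd : ∀ i, (V i).IsHomogeneous d) (hV : ∀ c, (∀ i, c ∣ V i) → IsUnit c)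
    (hK : ∀ i, Φ.toFun i = K * V i) : Φ.degree = d := by
  refine le_antisymm (Nat.sInf_le ⟨V, hd, hV, fun i j => by rw [hK, hK]; ring⟩) ?_
  refine le_csInf ⟨d, V, hd, hV, fun i j => by rw [hK, hK]; ring⟩ ?_
  rintro e ⟨P, hPe, hP, hPV⟩
  have hK0 : K ≠ 0 := by
    obtain ⟨i, hi⟩ := Φ.exists_ne_zero
    exact left_ne_zero_of_mul ((hK i) ▸ hi)
  have hPV' : ∀ i j, P i * V j = P j * V i := fun i j => by
    have := hPV i j
    rw [hK, hK] at this
    exact mul_left_cancel₀ hK0 (by linear_combination this)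
  obtain ⟨j, hj⟩ : ∃ j, V j ≠ 0 := by
    by_contra! h0
    exact not_isUnit_zero (hV 0 fun i => (h0 i).symm.dvd)
  obtain ⟨c, hc⟩ := dvd_of_forall_dvd_mul hj hV fun i => ⟨P i, by rw [← hPV' i j, mul_comm]⟩
  have hPc : ∀ i, P i = c * V i := fun i => mul_right_cancel₀ hj (by
    rw [hPV' i j, hc]; ring)
  obtain ⟨i, hi⟩ : ∃ i, P i ≠ 0 := by
    by_contra! h0
    exact not_isUnit_zero (hP 0 fun i => (h0 i).symm.dvd)
  have h1 := (hPe i).totalDegree hi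
  have hVi : V i ≠ 0 := right_ne_zero_of_mul ((hPc i) ▸ hi)
  have hci : c ≠ 0 := left_ne_zero_of_mul ((hPc i) ▸ hi)
  rw [hPc i, totalDegree_mul_of_isDomain hci hVi, (hd i).totalDegree hVi] at h1
  omega

/-- The degrees of the iterates of `g ∘ C₃` satisfy the recurrence. -/
lemma degree_iterate {A : GL (Fin 4) ℂ} {u v : Fin 4 → Fin 4 → ℂ} (hA : IsCycle A u v)
    {d f b c : ℕ → ℤ} (h0 : d 0 = 1 ∧ f 0 = 0 ∧ b 0 = 0 ∧ c 0 = 0)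
    (h : ∀ n, d (n + 1) = 3 * d n - 4 * f n ∧ f (n + 1) = c n ∧
      b (n + 1) = 2 * d n - 3 * f n ∧ c (n + 1) = b n) (n : ℕ) :
    ((((projectivity A).comp cremona).iterate n).degree : ℤ) = d n := by
  have key : ∀ n, ∃ (V : Fin 4 → Poly) (K : Poly) (d' x y z : ℕ),
      (∀ i, (((projectivity A).comp cremona).iterate n).toFun i = K * V i) ∧
      IsReduced u v V d' x y z ∧ (d' : ℤ) = d n ∧ (x : ℤ) = b n ∧ (y : ℤ) = f n ∧
      (z : ℤ) = c n := by
    intro n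
    induction n with
    | zero =>
      exact ⟨X, 1, 1, 0, 0, 0, fun i => (one_mul _).symm, isReduced_X hA.sq_u hA.sq_v,
        by simp [h0.1], by simp [h0.2.2.1], by simp [h0.2.1], by simp [h0.2.2.2]⟩
    | succ n ih =>
      obtain ⟨V, K, d', x, y, z, hVK, hV, hd, hx, hy, hz⟩ := ih
      obtain ⟨W, d'', x', hd', hx', hW, hWV⟩ := hV.step hA
      obtain ⟨e1, e2, e3, e4⟩ := h n
      refine ⟨W, aeval ((projectivity A).comp cremona).toFun K * coordProd ^ y, d'', x', z, x,
        fun i => ?_, hW, by omega, by omega, by omega, by omega⟩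
      rw [BirMap.iterate_succ_toFun, hVK, map_mul, mul_assoc, hWV]
  obtain ⟨V, K, d', x, y, z, hVK, hV, hd, -⟩ := key n
  rw [BirMap.degree_eq hV.hom hV.isUnit hVK, hd]

/-! ### The twelve points -/

lemma ne_zero_of_sq {w : Fin 4 → ℂ} (hw : ∀ i, w i ^ 2 = 1) : w ≠ 0 := fun h => by
  simpa [h] using hw 0

lemma pVec_sq (j i : Fin 4) : pVec j i ^ 2 = 1 := by
  fin_cases j <;> fin_cases i <;> simp [pVec]

lemma qVec_sq (j i : Fin 4) : qVec j i ^ 2 = 1 := by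
  fin_cases j <;> fin_cases i <;> simp [qVec]

lemma pVec_orthogonal (i j : Fin 4) : ∑ k, pVec i k * pVec j k = if i = j then 4 else 0 := by
  fin_cases i <;> fin_cases j <;> simp [pVec, Fin.sum_univ_four] <;> norm_num

lemma qVec_orthogonal (i j : Fin 4) : ∑ k, qVec i k * qVec j k = if i = j then 4 else 0 := by
  fin_cases i <;> fin_cases j <;> simp [qVec, Fin.sum_univ_four] <;> norm_num

lemma pVec_prod (j : Fin 4) : ∏ k, pVec j k = -1 := by
  fin_cases j <;> simp [pVec, Fin.prod_univ_four]

lemma qVec_prod (j : Fin 4) : ∏ k, qVec j k = 1 := by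
  fin_cases j <;> simp [qVec, Fin.prod_univ_four]

lemma mk_injective_of_orthogonal {w : Fin 4 → Fin 4 → ℂ} (h0 : ∀ j, w j ≠ 0)
    (hw : ∀ i j, ∑ k, w i k * w j k = if i = j then 4 else 0) :
    Function.Injective fun j => Projectivization.mk ℂ (w j) (h0 j) := by
  intro i j hij
  by_contra hne
  obtain ⟨c, hc⟩ := (Projectivization.mk_eq_mk_iff' _ _ _ _ _).mp hij
  have h1 := hw i j
  rw [if_neg hne, ← hc] at h1
  simp only [Pi.smul_apply, smul_eq_mul, mul_assoc, ← Finset.mul_sum] at h1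
  rw [hw j j, if_pos rfl] at h1
  have hc0 : c = 0 := by simpa using h1
  exact h0 i (by rw [← hc, hc0, zero_smul])

lemma pPt_injective : Function.Injective pPt := mk_injective_of_orthogonal _ pVec_orthogonal

lemma qPt_injective : Function.Injective qPt := mk_injective_of_orthogonal _ qVec_orthogonal

lemma ePt_injective : Function.Injective ePt := by
  intro i j hij
  obtain ⟨c, hc⟩ := (Projectivization.mk_eq_mk_iff' _ _ _ _ _).mp hij
  by_contra hne
  have := congrFun hc i
  simp [hne] at this

lemma ePt_ne_mk {w : Fin 4 → ℂ} (hw : ∀ i, w i ^ 2 = 1) (h0 : w ≠ 0) (j : Fin 4) :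
    ePt j ≠ Projectivization.mk ℂ w h0 := by
  intro h
  obtain ⟨c, hc⟩ := (Projectivization.mk_eq_mk_iff' _ _ _ _ _).mp h.symm
  have h1 := congrFun hc (j + 1)
  have h2 := hw (j + 1)
  rw [← h1] at h2
  simp at h2

lemma pPt_ne_qPt (i j : Fin 4) : pPt i ≠ qPt j := by
  intro h
  obtain ⟨c, hc⟩ := (Projectivization.mk_eq_mk_iff' _ _ _ _ _).mp h
  have h1 := pVec_prod i
  have h2 := pVec_sq i 0
  rw [← hc] at h1 h2
  simp only [Pi.smul_apply, smul_eq_mul, Finset.prod_mul_distrib, qVec_prod, mul_pow,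
    qVec_sq, Finset.prod_const, Finset.card_univ, Fintype.card_fin] at h1 h2
  have h3 : (c ^ 2) ^ 2 = -1 := by linear_combination h1
  rw [show c ^ 2 = 1 by linear_combination h2] at h3
  norm_num at h3

lemma mem_reye {x : P3} :
    x ∈ reye ↔ (∃ j, ePt j = x) ∨ (∃ j, pPt j = x) ∨ ∃ j, qPt j = x := by
  simp [reye]

/-- The twelve points, indexed by three copies of `Fin 4`. -/
noncomputable def reyeEquiv : Fin 4 ⊕ Fin 4 ⊕ Fin 4 ≃ reye :=
  Equiv.ofBijective (Sum.elim (fun j => ⟨ePt j, ePt_mem j⟩)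
    (Sum.elim (fun j => ⟨pPt j, pPt_mem j⟩) fun j => ⟨qPt j, qPt_mem j⟩)) <| by
    constructor
    · rintro (i | i | i) (j | j | j) h <;> have h' := congrArg Subtype.val h <;>
        simp only [Sum.elim_inl, Sum.elim_inr] at h'
      · rw [ePt_injective h']
      · exact absurd h' (ePt_ne_mk (pVec_sq j) _ _)
      · exact absurd h' (ePt_ne_mk (qVec_sq j) _ _)
      · exact absurd h'.symm (ePt_ne_mk (pVec_sq i) _ _)
      · rw [pPt_injective h']
      · exact absurd h' (pPt_ne_qPt _ _)
      · exact absurd h'.symm (ePt_ne_mk (qVec_sq i) _ _)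
      · exact absurd h'.symm (pPt_ne_qPt _ _)
      · rw [qPt_injective h']
    · rintro ⟨x, hx⟩
      rcases mem_reye.mp hx with ⟨j, rfl⟩ | ⟨j, rfl⟩ | ⟨j, rfl⟩
      · exact ⟨.inl j, rfl⟩
      · exact ⟨.inr (.inl j), rfl⟩
      · exact ⟨.inr (.inr j), rfl⟩

/-! ### The divisor class group of the blow-up -/

/-- Degree and multiplicities of a divisor class, on prime divisors: the strict transform of a
surface `S` has the class `deg(S) H - ∑_a mult_a(S) E_a`. -/
noncomputable def classOfPrime (Z : Finset P3) : PrimeDivisor Z → ℤ × (Z → ℤ)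
  | .strict S => (S.form.totalDegree, fun a => -((ordAt a.1.rep S.form).toNat : ℤ))
  | .exc a => by classical exact (0, Pi.single a 1)

/-- The coordinates of a divisor with respect to the plane class and the exceptional classes. -/
noncomputable def classCoords (Z : Finset P3) : Divisor Z →+ ℤ × (Z → ℤ) :=
  Finsupp.liftAddHom fun D => zmultiplesHom _ (classOfPrime Z D)

lemma classCoords_single (Z : Finset P3) (D : PrimeDivisor Z) (n : ℤ) :
    classCoords Z (Finsupp.single D n) = n • classOfPrime Z D := by
  simp [classCoords]

lemma classCoords_divForm (Z : Finset P3) (p : Poly) (hp : p ≠ 0)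
    (hom : ∃ d, p.IsHomogeneous d) : classCoords Z (divForm Z p hp) = ((p.totalDegree : ℤ), 0) := by
  classical
  induction p using UniqueFactorizationMonoid.induction_on_prime with
  | h₁ => exact absurd rfl hp
  | h₂ u hu =>
    rw [divForm_unit Z hp hu, map_zero, (isUnit_iff_totalDegree_of_isReduced.mp hu).2]
    rfl
  | h₃ q s hq hs ih =>
    obtain ⟨d, hd⟩ := hom
    have hs0 := hs.ne_zero
    have hom_s : ∃ d, s.IsHomogeneous d := ⟨_, isHomogeneous_of_mul hd hs0 hq⟩
    have hom_q : ∃ d, q.IsHomogeneous d :=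
      ⟨_, isHomogeneous_of_mul (by rwa [mul_comm] at hd) hq hs0⟩
    let S : Surface := ⟨Associates.mk s, Associates.irreducible_mk.mpr hs.irreducible,
      s, _, hom_s.choose_spec, rfl⟩
    have hass : Associated S.form s := Associates.mk_eq_mk_iff_associated.mp S.mk_form
    obtain ⟨u, hu⟩ := hass
    have hu0 : (u : Poly) ≠ 0 := u.ne_zero
    have hS0 := S.irreducible_form.ne_zero
    have hdeg : s.totalDegree = S.form.totalDegree := by
      rw [← hu, totalDegree_mul_of_isDomain hS0 hu0,
        (isUnit_iff_totalDegree_of_isReduced.mp u.isUnit).2, add_zero]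
    rw [divForm_mul Z hs0 hq, map_add, ih hq hom_q, divForm_congr Z hs0 hu.symm,
      divForm_mul Z hS0 hu0, divForm_unit Z hu0 u.isUnit, add_zero, divForm_surface, map_add,
      map_sum, classCoords_single, totalDegree_mul_of_isDomain hs0 hq, hdeg]
    simp only [classCoords_single, classOfPrime, one_smul]
    ext a
    · simp [Prod.fst_sum]
    · simp [Prod.snd_sum, Finset.sum_apply, Pi.single_apply]

lemma principal_le_ker_classCoords (Z : Finset P3) : principal Z ≤ (classCoords Z).ker := by
  refine (AddSubgroup.closure_le _).mpr ?_
  rintro _ ⟨d, p, q, hp, hq, hpd, hqd, rfl⟩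
  change classCoords Z _ = 0
  rw [map_sub, classCoords_divForm Z p hp ⟨d, hpd⟩, classCoords_divForm Z q hq ⟨d, hqd⟩,
    hpd.totalDegree hp, hqd.totalDegree hq, sub_self]

lemma divForm_pow (Z : Finset P3) {p : Poly} (hp : p ≠ 0) (n : ℕ) :
    divForm Z (p ^ n) (pow_ne_zero n hp) = n • divForm Z p hp := by
  induction n with
  | zero => rw [zero_smul, divForm_unit Z _ (by simp)]
  | succ n ih =>
    rw [divForm_congr Z _ (pow_succ p n), divForm_mul Z (pow_ne_zero n hp) hp, ih, succ_nsmul]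

/-- The pull-back of a surface of degree `d` has the class `d H`. -/
lemma mk_divForm (Z : Finset P3) {p : Poly} (hp : p ≠ 0) {d : ℕ} (hd : p.IsHomogeneous d) :
    (QuotientAddGroup.mk (divForm Z p hp) : DivClassGroup Z) = d • planeClass Z := by
  rw [planeClass, ← QuotientAddGroup.mk_nsmul, ← divForm_pow, eq_comm, QuotientAddGroup.eq]
  refine AddSubgroup.subset_closure ⟨d, p, X 0 ^ d, hp, pow_ne_zero _ (X_ne_zero 0), hd,
    isHomogeneous_X_pow _ _, ?_⟩
  abel

/-- Any homomorphism that maps the pull-back of each surface of degree `d` to `d H` is determined by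
the coordinates `classCoords`. -/
lemma map_eq_classCoords (Z : Finset P3) {G : Type*} [AddCommGroup G] (π : Divisor Z →+ G) (H : G)
    (hH : ∀ S : Surface, π (divForm Z S.form S.irreducible_form.ne_zero)
      = S.form.totalDegree • H) (D : Divisor Z) :
    π D = (classCoords Z D).1 • H
      + ∑ a : Z, (classCoords Z D).2 a • π (Finsupp.single (.exc a) 1) := by
  classical
  induction D using Finsupp.induction_linear with
  | zero => simp
  | add D D' h h' =>
    rw [map_add, h, h', map_add]
    simp only [Prod.fst_add, Prod.snd_add, Pi.add_apply, add_smul, Finset.sum_add_distrib]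
    abel
  | single D n =>
    rw [classCoords_single]
    have hn : ∀ (D : PrimeDivisor Z) (n : ℤ), (Finsupp.single D n : Divisor Z)
      = n • Finsupp.single D 1 := fun D n => by simp
    rw [hn, map_zsmul]
    simp only [Prod.smul_fst, Prod.smul_snd, Pi.smul_apply, smul_assoc, ← Finset.smul_sum,
      ← smul_add]
    congr 1
    cases D with
    | exc a =>
      simp only [classOfPrime, zero_smul, zero_add]
      rw [Finset.sum_eq_single a (fun b _ hb => by simp [hb]) (by simp)]
      simp
    | strict S =>
      have h := congrArg π (divForm_surface Z S)
      rw [hH, map_add, map_sum] at h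
      simp only [hn _ ((ordAt _ _).toNat : ℤ), map_zsmul] at h
      simp only [classOfPrime, neg_smul, Finset.sum_neg_distrib, natCast_zsmul] at h ⊢
      rw [h]
      abel

lemma existsUnique_of_classCoords (Z : Finset P3) {G : Type*} [AddCommGroup G] (π : Divisor Z →+ G)
    (H : G) (hH : ∀ S : Surface, π (divForm Z S.form S.irreducible_form.ne_zero)
      = S.form.totalDegree • H) (ψ : G →+ ℤ × (Z → ℤ)) (hψ : ∀ D, ψ (π D) = classCoords Z D)
    (hψH : ψ H = (1, 0)) (D : Divisor Z) :
    ∃! m : ℤ × (Z → ℤ), π D = m.1 • H + ∑ a : Z, m.2 a • π (Finsupp.single (.exc a) 1) := by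
  classical
  refine ⟨classCoords Z D, map_eq_classCoords Z π H hH D, ?_⟩
  rintro ⟨m, n⟩ h
  have hE : ∀ a : Z, ψ (π (Finsupp.single (.exc a) 1)) = (0, Pi.single a 1) := fun a => by
    rw [hψ, classCoords_single, one_smul]
    simp only [classOfPrime]
  rw [← hψ D, h]
  simp only [map_add, map_zsmul, map_sum, hψH, hE]
  ext a
  · simp [Prod.fst_sum]
  · simp [Prod.snd_sum, Finset.sum_apply, Pi.single_apply]

/-- The plane class and the exceptional classes form a basis of the class group of `Bl_Z ℙ³`. -/
lemma existsUnique_classCoords (Z : Finset P3) (D : DivClassGroup Z) :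
    ∃! m : ℤ × (Z → ℤ), D = m.1 • planeClass Z + ∑ a : Z, m.2 a • excClass Z a.1 a.2 := by
  obtain ⟨D, rfl⟩ := QuotientAddGroup.mk_surjective D
  refine existsUnique_of_classCoords Z (QuotientAddGroup.mk' (principal Z)) (planeClass Z)
    (fun S => mk_divForm Z S.irreducible_form.ne_zero
      (S.form_hom.choose_spec.totalDegree S.irreducible_form.ne_zero ▸ S.form_hom.choose_spec))
    (QuotientAddGroup.lift (principal Z) (classCoords Z) (principal_le_ker_classCoords Z))
    (fun _ => rfl) ?_ D
  change classCoords Z _ = _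
  rw [classCoords_divForm Z _ _ ⟨1, isHomogeneous_X ℂ 0⟩, totalDegree_X]
  rfl

lemma existsUnique_reye (D : DivClassGroup reye) :
    ∃! m : ℤ × (Fin 4 → ℤ) × (Fin 4 → ℤ) × (Fin 4 → ℤ),
      D = m.1 • planeClass reye + ∑ j, m.2.1 j • excClass reye (ePt j) (ePt_mem j)
        + ∑ j, m.2.2.1 j • excClass reye (pPt j) (pPt_mem j)
        + ∑ j, m.2.2.2 j • excClass reye (qPt j) (qPt_mem j) := by
  have key : ∀ n : reye → ℤ, ∑ a : reye, n a • excClass reye a.1 a.2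
      = ∑ j, n (reyeEquiv (.inl j)) • excClass reye (ePt j) (ePt_mem j)
        + ∑ j, n (reyeEquiv (.inr (.inl j))) • excClass reye (pPt j) (pPt_mem j)
        + ∑ j, n (reyeEquiv (.inr (.inr j))) • excClass reye (qPt j) (qPt_mem j) := fun n => by
    rw [← reyeEquiv.sum_comp, Fintype.sum_sum_type, Fintype.sum_sum_type, add_assoc]
    rfl
  obtain ⟨⟨m, n⟩, h, huniq⟩ := existsUnique_classCoords reye D
  refine ⟨⟨m, fun j => n (reyeEquiv (.inl j)), fun j => n (reyeEquiv (.inr (.inl j))),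
    fun j => n (reyeEquiv (.inr (.inr j)))⟩, ?_, ?_⟩
  · simp only at h ⊢
    rw [h, key]
    simp only [add_assoc]
  · rintro ⟨m', x, y, z⟩ h'
    have h1 := huniq (m', fun a => Sum.elim x (Sum.elim y z) (reyeEquiv.symm a)) (by
      simp only at h' ⊢
      rw [h', key]
      simp only [Equiv.symm_apply_apply, Sum.elim_inl, Sum.elim_inr, add_assoc])
    obtain ⟨rfl, rfl⟩ := Prod.mk.inj h1
    simp

/-! ### Push-forward of divisor classes -/

lemma emultiplicity_aeval_projectivity (A : GL (Fin 4) ℂ) (s q : Poly) :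
    emultiplicity s (aeval (projectivity A⁻¹).toFun q)
      = emultiplicity (aeval (projectivity A).toFun s : Poly) q := by
  refine emultiplicity_eq_emultiplicity_iff.mpr fun n => ⟨fun h => ?_, fun h => ?_⟩
  · simpa only [map_pow, aeval_projectivity_inv] using
      map_dvd (aeval (projectivity A).toFun : Poly →ₐ[ℂ] Poly) h
  · simpa only [map_pow, aeval_projectivity_inv'] using
      map_dvd (aeval (projectivity A⁻¹).toFun : Poly →ₐ[ℂ] Poly) h

lemma irreducible_aeval_projectivity (A : GL (Fin 4) ℂ) {s : Poly} (hs : Irreducible s) :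
    Irreducible (aeval (projectivity A).toFun s : Poly) := by
  let e : Poly ≃ₐ[ℂ] Poly := AlgEquiv.ofAlgHom (aeval (projectivity A).toFun)
    (aeval (projectivity A⁻¹).toFun) (AlgHom.ext fun p => aeval_projectivity_inv A p)
    (AlgHom.ext fun p => aeval_projectivity_inv' A p)
  exact (MulEquiv.irreducible_iff e).mpr hs

lemma exists_inv_mulVec_rep {A : GL (Fin 4) ℂ} {b : P3} {w : Fin 4 → ℂ} {hw : w ≠ 0}
    (h : b = Matrix.ProjGenLinGroup.mk A • Projectivization.mk ℂ w hw) :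
    ∃ c : ℂ, c ≠ 0 ∧ ((A⁻¹ : GL (Fin 4) ℂ) : Matrix (Fin 4) (Fin 4) ℂ).mulVec b.rep = c • w := by
  rw [Projectivization.PGL.mk_smul_mk] at h
  obtain ⟨a, ha⟩ := Projectivization.exists_smul_eq_mk_rep ℂ (A • w)
    ((smul_ne_zero_iff_ne A).2 hw)
  refine ⟨a, a.ne_zero, ?_⟩
  rw [h, ← ha]
  change Matrix.mulVec _ ((a : ℂ) • Matrix.mulVec (A : Matrix (Fin 4) (Fin 4) ℂ) w) = _
  rw [Matrix.mulVec_smul, Matrix.mulVec_mulVec, ← Units.val_mul, inv_mul_cancel, Units.val_one,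
    Matrix.one_mulVec]

/-- The order along the exceptional divisor over `g(w)` of the composite with `g⁻¹`. -/
lemma ordAt_rep_aeval_projectivity_inv {A : GL (Fin 4) ℂ} {b : P3} {w : Fin 4 → ℂ} {hw : w ≠ 0}
    (h : b = Matrix.ProjGenLinGroup.mk A • Projectivization.mk ℂ w hw) {p : Poly} {d : ℕ}
    (hp : p.IsHomogeneous d) :
    ordAt b.rep (aeval (projectivity A⁻¹).toFun p) = ordAt w p := by
  obtain ⟨c, hc, hcw⟩ := exists_inv_mulVec_rep h
  rw [ordAt_aeval_projectivity, hcw, ordAt_smul _ hc hp]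

/-- The inverse of `g ∘ C₃`, where `g` is the projectivity of matrix `A`. -/
noncomputable abbrev invMap (A : GL (Fin 4) ℂ) : BirMap := ((projectivity A).comp cremona).symm

lemma aeval_invMap (A : GL (Fin 4) ℂ) (p : Poly) :
    aeval (invMap A).toFun p
      = aeval (projectivity A⁻¹).toFun (aeval cremona.toFun p : Poly) := by
  rw [aeval_aeval]
  rfl

/-- The strict transform of the plane `g(x_j = 0)` is mapped by `C₃ ∘ g⁻¹` onto the exceptional
divisor over `e_j`. -/
lemma ord_strict_aeval_invMap {A : GL (Fin 4) ℂ} {Z : Finset P3} {S : Surface} {j : Fin 4}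
    (hS : Associated (aeval (projectivity A).toFun S.form : Poly) (X j)) {p : Poly} {d : ℕ}
    (hp : p.IsHomogeneous d) :
    (PrimeDivisor.strict S : PrimeDivisor Z).ord (aeval (invMap A).toFun p)
      = ordAt (eVec j) p := by
  rw [aeval_invMap, PrimeDivisor.ord, emultiplicity_aeval_projectivity,
    ← emultiplicity_eq_of_associated_left hS, emultiplicity_aeval_cremona hp]

/-- A surface `S` other than the planes `g(x_j = 0)` is mapped by `C₃ ∘ g⁻¹` onto a surface `t = 0`:
if `S` divides `p ∘ C₃ ∘ g⁻¹`, then `t` divides `p`. -/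
lemma exists_dvd_of_ord_strict_ne_zero {A : GL (Fin 4) ℂ} {Z : Finset P3} {S : Surface}
    (hS : ∀ j, ¬ Associated (aeval (projectivity A).toFun S.form : Poly) (X j)) :
    ∃ t : Poly, Irreducible t ∧ ∀ (p : Poly) (d : ℕ), p.IsHomogeneous d →
      (PrimeDivisor.strict S : PrimeDivisor Z).ord (aeval (invMap A).toFun p) ≠ 0 → t ∣ p := by
  obtain ⟨d, hd⟩ := S.form_hom
  obtain ⟨t, ht, hts, htc⟩ := exists_irreducible_dvd_aeval_cremona
    (irreducible_aeval_projectivity A S.irreducible_form) (hd.aeval _ (projectivity_hom A)) hS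
  refine ⟨t, ht, fun p e hp h => ?_⟩
  rw [aeval_invMap, PrimeDivisor.ord, emultiplicity_aeval_projectivity, emultiplicity_ne_zero] at h
  have h1 := map_dvd (aeval cremona.toFun : Poly →ₐ[ℂ] Poly) h
  rw [aeval_cremona_aeval_cremona hp] at h1
  refine (ht.prime.dvd_or_dvd (hts.trans h1)).resolve_left fun h2 => htc ?_
  exact ht.prime.dvd_of_dvd_pow (ht.prime.dvd_of_dvd_pow h2)

/-- The exceptional divisors over `g(w)`, for `w` a fixed point of `C₃`, are mapped onto those over
`w`. -/
lemma ord_exc_aeval_invMap_of_sq {A : GL (Fin 4) ℂ} {Z : Finset P3} {b : Z} {w : Fin 4 → ℂ}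
    {hw : w ≠ 0} (h : b.1 = Matrix.ProjGenLinGroup.mk A • Projectivization.mk ℂ w hw)
    (hsq : ∀ i, w i ^ 2 = 1) {p : Poly} {d : ℕ} (hp : p.IsHomogeneous d) :
    (PrimeDivisor.exc b).ord (aeval (invMap A).toFun p) = ordAt w p := by
  rw [aeval_invMap, PrimeDivisor.ord, ordAt_rep_aeval_projectivity_inv h (hp.aeval _ cremona_hom),
    ordAt_aeval_cremona_of_sq hsq hp]

/-- The exceptional divisors over `g(e_m)` are mapped onto the planes `x_m = 0`. -/
lemma ord_exc_aeval_invMap_of_eVec {A : GL (Fin 4) ℂ} {Z : Finset P3} {b : Z} {m : Fin 4}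
    (h : b.1 = Matrix.ProjGenLinGroup.mk A • ePt m) {p : Poly} {d : ℕ} (hp : p.IsHomogeneous d) :
    (PrimeDivisor.exc b).ord (aeval (invMap A).toFun p)
      = (2 * d : ℕ) + emultiplicity (X m) p := by
  rw [aeval_invMap, PrimeDivisor.ord, ordAt_rep_aeval_projectivity_inv h (hp.aeval _ cremona_hom),
    ordAt_eVec_aeval_cremona hp]

lemma iInf_eq_of_forall_le {ι : Sort*} {f : ι → ℕ∞} {n : ℕ∞} (h : ∀ i, n ≤ f i)
    (h' : ∃ i, f i = n) : ⨅ i, f i = n :=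
  le_antisymm (h'.elim fun i hi => (iInf_le f i).trans_eq hi) (le_iInf h)

/-- There are two different planes through a given point. -/
lemma exists_two_linForm {v : Fin 4 → ℂ} (hv : v ≠ 0) :
    ∃ l l' : {l : Fin 4 → ℂ // ∑ i, l i * v i = 0},
    l.1 ≠ 0 ∧ ∀ c : ℂ, l'.1 ≠ c • l.1 := by
  obtain ⟨i, hi⟩ := Function.ne_iff.mp hv
  have key : ∀ k, ∑ m, (v i • eVec k - v k • eVec i) m * v m = 0 := fun k => by
    simp only [Pi.sub_apply, Pi.smul_apply, smul_eq_mul, sub_mul, Finset.sum_sub_distrib,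
      Pi.single_apply, mul_ite, mul_one, mul_zero, ite_mul, zero_mul, Finset.sum_ite_eq',
      Finset.mem_univ, if_true]
    ring
  have h1 : i + 1 ≠ i := by fin_cases i <;> decide
  have h2 : i + 2 ≠ i := by fin_cases i <;> decide
  have h3 : i + 2 ≠ i + 1 := by fin_cases i <;> decide
  refine ⟨⟨_, key (i + 1)⟩, ⟨_, key (i + 2)⟩, fun h => hi ?_, fun c h => hi ?_⟩
  · simpa [h1] using congrFun h (i + 1)
  · simpa [h2, h3] using congrFun h (i + 2)

/-- The planes through a point have no common component. -/
lemma exists_linForm_not_dvd {v : Fin 4 → ℂ} (hv : v ≠ 0) {s : Poly} (hs : ¬ IsUnit s) :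
    ∃ l : {l : Fin 4 → ℂ // ∑ i, l i * v i = 0}, ¬ s ∣ linForm l.1 := by
  obtain ⟨l, l', hl, hl'⟩ := exists_two_linForm hv
  by_contra! h
  obtain ⟨c, hc⟩ := exists_smul_of_dvd_linForm hs hl (h l) (h l')
  exact hl' c hc

open Classical in
/-- The planes through the point `a` meet in `a` only. -/
lemma iInf_ordAt_linForm (a : P3) {w : Fin 4 → ℂ} (hw : w ≠ 0) :
    ⨅ l : {l : Fin 4 → ℂ // ∑ i, l i * a.rep i = 0}, ordAt w (linForm l.1)
      = if a = Projectivization.mk ℂ w hw then 1 else 0 := by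
  split_ifs with h
  · obtain ⟨c, hc⟩ := Projectivization.exists_smul_eq_mk_rep ℂ w hw
    have hl : ∀ l : {l : Fin 4 → ℂ // ∑ i, l i * a.rep i = 0}, ∑ i, l.1 i * w i = 0 := fun l => by
      have hrep : a.rep = c • w := by rw [hc, h]
      have := l.2
      simp only [hrep] at this
      have h2 : ∑ i, l.1 i * (c • w) i = c * ∑ i, l.1 i * w i := by
        rw [Finset.mul_sum]
        refine Finset.sum_congr rfl fun i _ => ?_
        rw [Units.smul_def, Pi.smul_apply, smul_eq_mul]
        ring
      rw [h2] at this
      exact (mul_eq_zero.mp this).resolve_left c.ne_zero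
    obtain ⟨l, -, hl0, -⟩ := exists_two_linForm a.rep_nonzero
    exact iInf_eq_of_forall_le
      (fun l => (one_le_ordAt_iff _ _).mpr (by rw [eval_linForm, hl l]))
      ⟨l, ordAt_linForm hl0 (hl l)⟩
  · refine iInf_eq_of_forall_le (fun _ => zero_le) ?_
    by_contra! hne
    apply h
    have key : ∀ l : Fin 4 → ℂ, ∑ i, l i * a.rep i = 0 → ∑ i, l i * w i = 0 := fun l hl => by
      by_contra h1
      exact hne ⟨l, hl⟩ (ordAt_linForm_of_ne h1)
    obtain ⟨i, hi⟩ := Function.ne_iff.mp a.rep_nonzero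
    have hcoord : ∀ k, a.rep i * w k = a.rep k * w i := fun k => by
      have h2 : ∀ v : Fin 4 → ℂ, ∑ m, (a.rep i • eVec k - a.rep k • eVec i) m * v m
          = a.rep i * v k - a.rep k * v i := fun v => by
        simp only [Pi.sub_apply, Pi.smul_apply, smul_eq_mul, sub_mul, Finset.sum_sub_distrib,
          Pi.single_apply, mul_ite, mul_one, mul_zero, ite_mul, zero_mul, Finset.sum_ite_eq',
          Finset.mem_univ, if_true]
      have h3 := key (a.rep i • eVec k - a.rep k • eVec i) (by rw [h2]; ring)
      rw [h2] at h3
      exact sub_eq_zero.mp h3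
    have hi' : a.rep i ≠ 0 := hi
    rw [← a.mk_rep, eq_comm, Projectivization.mk_eq_mk_iff']
    refine ⟨w i / a.rep i, ?_⟩
    ext k
    rw [Pi.smul_apply, smul_eq_mul]
    field_simp
    linear_combination - hcoord k

lemma fixedPart_apply {Z : Finset P3} {Φ : BirMap} {D : PrimeDivisor Z} {n : ℕ}
    (h : ∀ i, (n : ℕ∞) ≤ D.ord (Φ.toFun i)) (h' : ∃ i, D.ord (Φ.toFun i) = n) :
    fixedPart Z Φ D = n := by
  change (((⨅ i, D.ord (Φ.toFun i)).toNat : ℕ) : ℤ) = n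
  rw [iInf_eq_of_forall_le h h', ENat.toNat_natCast]

lemma pullExc_apply {Z : Finset P3} {Φ : BirMap} {a : Z} {D : PrimeDivisor Z} {n : ℕ}
    (h : ⨅ l : {l : Fin 4 → ℂ // ∑ i, l i * a.1.rep i = 0},
      D.ord (aeval Φ.toFun (linForm l.1)) = n) :
    pullExc Z Φ a D = n - fixedPart Z Φ D := by
  rw [pullExc, Finsupp.sub_apply]
  change (((⨅ l : {l : Fin 4 → ℂ // ∑ i, l i * a.1.rep i = 0},
      D.ord (aeval Φ.toFun (linForm l.1))).toNat : ℕ) : ℤ) - _ = _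
  rw [h, ENat.toNat_natCast]

lemma divForm_apply {Z : Finset P3} {p : Poly} (hp : p ≠ 0) {D : PrimeDivisor Z} {n : ℕ}
    (h : D.ord p = n) : divForm Z p hp D = n := by
  change (((D.ord p).toNat : ℕ) : ℤ) = n
  rw [h, ENat.toNat_natCast]

lemma toFun_eq_aeval_X (Φ : BirMap) (i : Fin 4) : Φ.toFun i = aeval Φ.toFun (X i : Poly) :=
  (aeval_X _ _).symm

/-- The forms that represent `C₃ ∘ g⁻¹` have no common factor. -/
lemma fixedPart_strict {A : GL (Fin 4) ℂ} {Z : Finset P3} (S : Surface) :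
    fixedPart Z (invMap A) (.strict S) = 0 := by
  refine fixedPart_apply (n := 0) (fun i => by simp) ?_
  simp only [toFun_eq_aeval_X]
  by_cases hS : ∃ j, Associated (aeval (projectivity A).toFun S.form : Poly) (X j)
  · obtain ⟨j, hj⟩ := hS
    exact ⟨j, by rw [ord_strict_aeval_invMap hj (isHomogeneous_X ℂ j), ordAt_eVec_X_self]; rfl⟩
  · push Not at hS
    obtain ⟨t, ht, h⟩ := exists_dvd_of_ord_strict_ne_zero (Z := Z) hS
    by_contra! hne
    have h1 := fun i => h (X i) 1 (isHomogeneous_X ℂ i) (hne i)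
    have h2 := (X_prime (R := ℂ) (i := (0 : Fin 4))).irreducible.isRelPrime_iff_not_dvd.mpr
      (fun h : (X 0 : Poly) ∣ X 1 => absurd (X_dvd_X.mp h) (by decide))
    exact ht.not_isUnit (h2 (h1 0) (h1 1))

lemma fixedPart_exc_of_sq {A : GL (Fin 4) ℂ} {Z : Finset P3} {b : Z} {w : Fin 4 → ℂ}
    {hw : w ≠ 0} (h : b.1 = Matrix.ProjGenLinGroup.mk A • Projectivization.mk ℂ w hw)
    (hsq : ∀ i, w i ^ 2 = 1) : fixedPart Z (invMap A) (.exc b) = 0 := by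
  refine fixedPart_apply (n := 0) (fun i => by simp) ⟨0, ?_⟩
  rw [toFun_eq_aeval_X, ord_exc_aeval_invMap_of_sq h hsq (isHomogeneous_X ℂ 0), Nat.cast_zero,
    ordAt_eq_zero_iff, eval_X]
  exact fun h0 => by simpa [h0] using hsq 0

lemma fixedPart_exc_of_eVec {A : GL (Fin 4) ℂ} {Z : Finset P3} {b : Z} {m : Fin 4}
    (h : b.1 = Matrix.ProjGenLinGroup.mk A • ePt m) :
    fixedPart Z (invMap A) (.exc b) = 2 := by
  refine fixedPart_apply (n := 2) (fun i => ?_) ⟨m + 1, ?_⟩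
  · rw [toFun_eq_aeval_X, ord_exc_aeval_invMap_of_eVec h (isHomogeneous_X ℂ i)]
    exact le_self_add
  · rw [toFun_eq_aeval_X, ord_exc_aeval_invMap_of_eVec h (isHomogeneous_X ℂ _),
      emultiplicity_eq_zero.mpr, add_zero]
    intro hd
    have := X_dvd_X.mp hd
    revert this
    fin_cases m <;> decide

open Classical in
lemma pullExc_strict {A : GL (Fin 4) ℂ} {Z : Finset P3} (a : Z) {S : Surface} {j : Fin 4}
    (hS : Associated (aeval (projectivity A).toFun S.form : Poly) (X j)) :
    pullExc Z (invMap A) a (.strict S) = if a.1 = ePt j then 1 else 0 := by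
  rw [pullExc_apply (n := if a.1 = ePt j then 1 else 0), fixedPart_strict, sub_zero]
  · split_ifs <;> rfl
  · simp only [ord_strict_aeval_invMap hS (linForm_hom _)]
    rw [iInf_ordAt_linForm a.1 (w := eVec j) (by simp)]
    change (if a.1 = ePt j then _ else _) = _
    split_ifs <;> rfl

lemma pullExc_strict_eq_zero {A : GL (Fin 4) ℂ} {Z : Finset P3} (a : Z) {S : Surface}
    (hS : ∀ j, ¬ Associated (aeval (projectivity A).toFun S.form : Poly) (X j)) :
    pullExc Z (invMap A) a (.strict S) = 0 := by
  rw [pullExc_apply (n := 0), fixedPart_strict, Nat.cast_zero, sub_zero]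
  obtain ⟨t, ht, h⟩ := exists_dvd_of_ord_strict_ne_zero (Z := Z) hS
  obtain ⟨l, hl⟩ := exists_linForm_not_dvd a.1.rep_nonzero ht.not_isUnit
  refine iInf_eq_of_forall_le (fun _ => by simp) ⟨l, ?_⟩
  by_contra hne
  exact hl (h _ 1 (linForm_hom _) hne)

open Classical in
lemma pullExc_exc_of_sq {A : GL (Fin 4) ℂ} {Z : Finset P3} (a : Z) {b : Z} {w : Fin 4 → ℂ}
    {hw : w ≠ 0} (h : b.1 = Matrix.ProjGenLinGroup.mk A • Projectivization.mk ℂ w hw)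
    (hsq : ∀ i, w i ^ 2 = 1) :
    pullExc Z (invMap A) a (.exc b) = if a.1 = Projectivization.mk ℂ w hw then 1 else 0 := by
  rw [pullExc_apply (n := if a.1 = Projectivization.mk ℂ w hw then 1 else 0),
    fixedPart_exc_of_sq h hsq, sub_zero]
  · split_ifs <;> rfl
  · simp only [ord_exc_aeval_invMap_of_sq h hsq (linForm_hom _)]
    rw [iInf_ordAt_linForm a.1 hw]
    split_ifs <;> rfl

/-- Both minima in the multiplicity are `2`, as some plane through `a` is not `x_m = 0`. -/
lemma pullExc_exc_of_eVec {A : GL (Fin 4) ℂ} {Z : Finset P3} (a : Z) {b : Z} {m : Fin 4}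
    (h : b.1 = Matrix.ProjGenLinGroup.mk A • ePt m) :
    pullExc Z (invMap A) a (.exc b) = 0 := by
  rw [pullExc_apply (n := 2), fixedPart_exc_of_eVec h]
  · rfl
  · simp only [ord_exc_aeval_invMap_of_eVec h (linForm_hom _)]
    obtain ⟨l, hl⟩ := exists_linForm_not_dvd a.1.rep_nonzero
      (X_prime (R := ℂ) (i := m)).not_isUnit
    exact iInf_eq_of_forall_le (fun _ => le_self_add)
      ⟨l, by rw [emultiplicity_eq_zero.mpr hl, add_zero]⟩

lemma exists_eq_smul_of_mem_reye {A : GL (Fin 4) ℂ}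
    (hA : Matrix.ProjGenLinGroup.mk A ∈ cremonaCubes) {b : P3} (hb : b ∈ reye) :
    (∃ m, b = Matrix.ProjGenLinGroup.mk A • ePt m) ∨ ∃ (w : Fin 4 → ℂ) (hw : w ≠ 0),
      (∀ i, w i ^ 2 = 1) ∧ b = Matrix.ProjGenLinGroup.mk A • Projectivization.mk ℂ w hw := by
  have h1 : (Matrix.ProjGenLinGroup.mk A)⁻¹ • b ∈ reye := cremonaCubes.inv_mem hA b hb
  rcases mem_reye.mp h1 with ⟨j, hj⟩ | ⟨j, hj⟩ | ⟨j, hj⟩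
  · exact .inl ⟨j, by rw [hj, smul_inv_smul]⟩
  · exact .inr ⟨pVec j, pVec_ne_zero j, pVec_sq j, by
      change b = _ • pPt j; rw [hj, smul_inv_smul]⟩
  · exact .inr ⟨qVec j, qVec_ne_zero j, qVec_sq j, by
      change b = _ • qPt j; rw [hj, smul_inv_smul]⟩

/-- The image in the centre `R` of a point of `R` under an element of the Cremona-cubes group. -/
noncomputable def imgPt {A : GL (Fin 4) ℂ} (hA : Matrix.ProjGenLinGroup.mk A ∈ cremonaCubes)
    (x : P3) (hx : x ∈ reye) : reye := ⟨Matrix.ProjGenLinGroup.mk A • x, hA x hx⟩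

lemma imgPt_eq_iff {A : GL (Fin 4) ℂ} (hA : Matrix.ProjGenLinGroup.mk A ∈ cremonaCubes)
    {x y : P3} (hx : x ∈ reye) {b : reye} (hb : b.1 = Matrix.ProjGenLinGroup.mk A • y) :
    imgPt hA x hx = b ↔ x = y := by
  rw [Subtype.ext_iff, hb]
  exact smul_left_cancel_iff _

lemma single_exc_apply {Z : Finset P3} [DecidableEq P3] (a b : Z) :
    (Finsupp.single (.exc a) 1 : Divisor Z) (.exc b) = if a = b then 1 else 0 := by
  classical
  rw [Finsupp.single_apply]
  simp

lemma single_exc_apply_strict {Z : Finset P3} (a : Z) (S : Surface) :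
    (Finsupp.single (.exc a) 1 : Divisor Z) (.strict S) = 0 := by
  classical
  rw [Finsupp.single_apply, if_neg (by simp)]

/-- The fixed part of `C₃ ∘ g⁻¹` is twice the sum of the exceptional divisors over the `g(e_j)`. -/
lemma fixedPart_invMap {A : GL (Fin 4) ℂ} (hA : Matrix.ProjGenLinGroup.mk A ∈ cremonaCubes) :
    fixedPart reye (invMap A)
      = 2 • ∑ j, Finsupp.single (.exc (imgPt hA (ePt j) (ePt_mem j))) 1 := by
  classical
  ext D
  rw [Finsupp.smul_apply, Finsupp.finsetSum_apply]
  cases D with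
  | strict S => simp [fixedPart_strict]
  | exc b =>
    simp only [single_exc_apply]
    rcases exists_eq_smul_of_mem_reye hA b.2 with ⟨m, hm⟩ | ⟨w, hw, hsq, hbw⟩
    · simp [fixedPart_exc_of_eVec hm, imgPt_eq_iff hA (ePt_mem _) hm, ePt_injective.eq_iff]
    · simp [fixedPart_exc_of_sq hbw hsq, imgPt_eq_iff hA (ePt_mem _) hbw, ePt_ne_mk hsq hw]

/-- The exceptional divisor over a fixed point of `C₃` is mapped onto the one over its image
under `g`. -/
lemma pullExc_of_sq {A : GL (Fin 4) ℂ} (hA : Matrix.ProjGenLinGroup.mk A ∈ cremonaCubes)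
    {w : Fin 4 → ℂ} {hw : w ≠ 0} (hsq : ∀ i, w i ^ 2 = 1)
    (hmem : Projectivization.mk ℂ w hw ∈ reye) :
    pullExc reye (invMap A) ⟨_, hmem⟩ = Finsupp.single (.exc (imgPt hA _ hmem)) 1 := by
  classical
  ext D
  cases D with
  | strict S =>
    rw [single_exc_apply_strict]
    by_cases hS : ∃ j, Associated (aeval (projectivity A).toFun S.form : Poly) (X j)
    · obtain ⟨j, hj⟩ := hS
      rw [pullExc_strict _ hj, if_neg (ePt_ne_mk hsq hw j).symm]
    · push Not at hS
      exact pullExc_strict_eq_zero _ hS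
  | exc b =>
    rw [single_exc_apply]
    rcases exists_eq_smul_of_mem_reye hA b.2 with ⟨m, hm⟩ | ⟨w', hw', hsq', hbw⟩
    · rw [pullExc_exc_of_eVec _ hm, if_neg]
      rw [imgPt_eq_iff hA _ hm]
      exact (ePt_ne_mk hsq hw m).symm
    · rw [pullExc_exc_of_sq _ hbw hsq']
      simp only [imgPt_eq_iff hA _ hbw]

lemma projectivity_ne_zero (A : GL (Fin 4) ℂ) (k : Fin 4) : (projectivity A).toFun k ≠ 0 := by
  rw [toFun_eq_aeval_X]
  exact (projectivity A).aeval_ne_zero (isHomogeneous_X ℂ k) (X_ne_zero k)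

/-- The exceptional divisor over `e_k` is mapped onto the strict transform of the plane
`g(x_k = 0)`. -/
lemma pullExc_ePt {A : GL (Fin 4) ℂ} (hA : Matrix.ProjGenLinGroup.mk A ∈ cremonaCubes)
    (k : Fin 4) :
    pullExc reye (invMap A) ⟨ePt k, ePt_mem k⟩
      = divForm reye ((projectivity A⁻¹).toFun k) (projectivity_ne_zero _ k)
        - (∑ j, Finsupp.single (.exc (imgPt hA (ePt j) (ePt_mem j))) 1
          - Finsupp.single (.exc (imgPt hA (ePt k) (ePt_mem k))) 1) := by
  classical
  ext D
  rw [Finsupp.sub_apply, Finsupp.sub_apply, Finsupp.finsetSum_apply]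
  cases D with
  | strict S =>
    simp only [single_exc_apply_strict, Finset.sum_const_zero, sub_zero]
    have hord : (PrimeDivisor.strict S : PrimeDivisor reye).ord ((projectivity A⁻¹).toFun k)
        = emultiplicity (aeval (projectivity A).toFun S.form : Poly) (X k) := by
      rw [toFun_eq_aeval_X, PrimeDivisor.ord, emultiplicity_aeval_projectivity]
    by_cases hS : ∃ j, Associated (aeval (projectivity A).toFun S.form : Poly) (X j)
    · obtain ⟨j, hj⟩ := hS
      rw [pullExc_strict _ hj, divForm_apply (n := if k = j then 1 else 0)]
      · simp only [ePt_injective.eq_iff]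
        split_ifs <;> rfl
      · rw [hord, ← emultiplicity_eq_of_associated_left hj]
        split_ifs with h
        · rw [h]
          exact (FiniteMultiplicity.of_not_isUnit X_prime.not_isUnit
            (X_ne_zero j)).emultiplicity_self
        · exact emultiplicity_eq_zero.mpr fun hd => h (X_dvd_X.mp hd).symm
    · push Not at hS
      rw [pullExc_strict_eq_zero _ hS, divForm_apply (n := 0)]
      · rfl
      · rw [hord]
        exact emultiplicity_eq_zero.mpr fun hd => hS k
          ((irreducible_aeval_projectivity A S.irreducible_form).associated_of_dvd
            X_prime.irreducible hd)
  | exc b =>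
    simp only [single_exc_apply]
    have hord : ∀ {w : Fin 4 → ℂ} {hw : w ≠ 0},
        b.1 = Matrix.ProjGenLinGroup.mk A • Projectivization.mk ℂ w hw →
        (PrimeDivisor.exc b).ord ((projectivity A⁻¹).toFun k) = ordAt w (X k) := fun h => by
      rw [toFun_eq_aeval_X, PrimeDivisor.ord,
        ordAt_rep_aeval_projectivity_inv h (isHomogeneous_X ℂ k)]
    rcases exists_eq_smul_of_mem_reye hA b.2 with ⟨m, hm⟩ | ⟨w, hw, hsq, hbw⟩
    · rw [pullExc_exc_of_eVec _ hm, divForm_apply (n := if k = m then 0 else 1)]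
      · simp only [imgPt_eq_iff hA (ePt_mem _) hm, ePt_injective.eq_iff]
        split_ifs <;> simp
      · rw [hord hm]
        split_ifs with h
        · rw [h]
          exact ordAt_eVec_X_self m
        · exact ordAt_eVec_X_of_ne h
    · rw [pullExc_exc_of_sq _ hbw hsq, divForm_apply (n := 0)]
      · simp [imgPt_eq_iff hA (ePt_mem _) hbw, ePt_ne_mk hsq hw]
      · rw [hord hbw, Nat.cast_zero, ordAt_eq_zero_iff, eval_X]
        exact fun h0 => by simpa [h0] using hsq k

lemma pushforward_planeClass {A : GL (Fin 4) ℂ}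
    (hA : Matrix.ProjGenLinGroup.mk A ∈ cremonaCubes) :
    pushforward reye ((projectivity A).comp cremona) (planeClass reye)
      = (3 : ℤ) • planeClass reye
        - (2 : ℤ) • ∑ j, excClass reye _ (imgPt hA (ePt j) (ePt_mem j)).2 := by
  have hX := isHomogeneous_X ℂ (0 : Fin 4)
  have hdeg : (aeval (invMap A).toFun (X 0 : Poly) : Poly).IsHomogeneous 3 := by
    have := (hX.aeval _ cremona_hom).aeval _ (projectivity_hom A⁻¹)
    rwa [← aeval_invMap] at this
  change QuotientAddGroup.mk' (principal reye) (pullDiv reye (invMap A)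
    (divForm reye (X 0) (X_ne_zero 0))) = _
  rw [pullDiv_divForm _ _ _ _ ⟨1, hX⟩, pullForm, map_sub, map_nsmul, totalDegree_X, one_smul,
    fixedPart_invMap hA, map_nsmul, map_sum]
  refine congrArg₂ (· - ·) ((mk_divForm reye _ hdeg).trans ?_) ?_
  · exact (natCast_zsmul _ 3).symm
  · exact (natCast_zsmul _ 2).symm

lemma pushforward_excClass_ePt {A : GL (Fin 4) ℂ}
    (hA : Matrix.ProjGenLinGroup.mk A ∈ cremonaCubes) (k : Fin 4) :
    pushforward reye ((projectivity A).comp cremona) (excClass reye (ePt k) (ePt_mem k))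
      = planeClass reye - (∑ j, excClass reye _ (imgPt hA (ePt j) (ePt_mem j)).2
        - excClass reye _ (imgPt hA (ePt k) (ePt_mem k)).2) := by
  change QuotientAddGroup.mk' (principal reye) (pullDiv reye (invMap A) (Finsupp.single _ 1)) = _
  rw [pullDiv_single, one_smul, pullPrime, pullExc_ePt hA, map_sub, map_sub, map_sum]
  refine congrArg₂ (· - ·) ((mk_divForm reye _ (projectivity_hom A⁻¹ k)).trans ?_) rfl
  exact one_nsmul _

lemma pushforward_excClass_of_sq {A : GL (Fin 4) ℂ}
    (hA : Matrix.ProjGenLinGroup.mk A ∈ cremonaCubes)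
    {w : Fin 4 → ℂ} {hw : w ≠ 0} (hsq : ∀ i, w i ^ 2 = 1)
    (hmem : Projectivization.mk ℂ w hw ∈ reye) :
    pushforward reye ((projectivity A).comp cremona) (excClass reye _ hmem)
      = excClass reye _ (imgPt hA _ hmem).2 := by
  change QuotientAddGroup.mk' (principal reye) (pullDiv reye (invMap A) (Finsupp.single _ 1)) = _
  rw [pullDiv_single, one_smul, pullPrime, pullExc_of_sq hA hsq]
  rfl

/-- Iteration of an endomorphism acting by the matrix of the push-forward. -/
lemma pow_apply_of_cycle {G : Type*} [AddCommGroup G] (T : AddMonoid.End G) {H E U V : G}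
    (hH : T H = (3 : ℤ) • H - (2 : ℤ) • U) (hE : T E = (4 : ℤ) • H - (3 : ℤ) • U) (hU : T U = V)
    (hV : T V = E) {d f b c : ℕ → ℤ} (h0 : d 0 = 1 ∧ f 0 = 0 ∧ b 0 = 0 ∧ c 0 = 0)
    (h : ∀ n, d (n + 1) = 3 * d n - 4 * f n ∧ f (n + 1) = c n ∧
      b (n + 1) = 2 * d n - 3 * f n ∧ c (n + 1) = b n) (n : ℕ) :
    (T ^ n) H = d n • H - f n • E - b n • U - c n • V := by
  induction n with
  | zero => simp [h0.1, h0.2.1, h0.2.2.1, h0.2.2.2]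
  | succ n ih =>
    obtain ⟨e1, e2, e3, e4⟩ := h n
    rw [pow_succ']
    change T ((T ^ n) H) = _
    rw [ih, map_sub, map_sub, map_sub, map_zsmul, map_zsmul,
      map_zsmul, map_zsmul, hH, hE, hU, hV, e1, e2, e3, e4]
    module

/-! ### Type (C) -/

/-- The twelve points are the coordinate points and the points represented by the vectors `u j` and
`v j`; the latter are pairwise orthogonal. -/
structure IsReye (u v : Fin 4 → Fin 4 → ℂ) : Prop where
  sq_u : ∀ j i, u j i ^ 2 = 1
  sq_v : ∀ j i, v j i ^ 2 = 1
  inj_u : Function.Injective fun j => Projectivization.mk ℂ (u j) (ne_zero_of_sq (sq_u j))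
  inj_v : Function.Injective fun j => Projectivization.mk ℂ (v j) (ne_zero_of_sq (sq_v j))
  u_ne_v : ∀ i j, Projectivization.mk ℂ (u i) (ne_zero_of_sq (sq_u i))
    ≠ Projectivization.mk ℂ (v j) (ne_zero_of_sq (sq_v j))
  orthogonal : ∀ i j, ∑ k, v i k * v j k = if i = j then 4 else 0
  mem_iff : ∀ x : P3, x ∈ reye ↔ (∃ j, ePt j = x) ∨
    (∃ j, Projectivization.mk ℂ (u j) (ne_zero_of_sq (sq_u j)) = x) ∨
    ∃ j, Projectivization.mk ℂ (v j) (ne_zero_of_sq (sq_v j)) = x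

lemma isReye_pVec_qVec : IsReye pVec qVec :=
  ⟨pVec_sq, qVec_sq, pPt_injective, qPt_injective, pPt_ne_qPt, qVec_orthogonal,
    fun _ => mem_reye⟩

lemma isReye_qVec_pVec : IsReye qVec pVec :=
  ⟨qVec_sq, pVec_sq, qPt_injective, pPt_injective, fun i j => (pPt_ne_qPt j i).symm,
    pVec_orthogonal, fun _ => mem_reye.trans (or_congr_right or_comm)⟩

lemma colPt_eq (A : GL (Fin 4) ℂ) (j : Fin 4) :
    colPt A j = Matrix.ProjGenLinGroup.mk A • ePt j := by
  rw [ePt, Projectivization.PGL.mk_smul_mk, colPt, Projectivization.mk_eq_mk_iff']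
  refine ⟨1, ?_⟩
  rw [one_smul]
  change Matrix.mulVec _ _ = _
  rw [Matrix.mulVec_single_one]
  rfl

lemma exists_mulVec_eq_smul {A : GL (Fin 4) ℂ} {w w' : Fin 4 → ℂ} {hw : w ≠ 0} {hw' : w' ≠ 0}
    (h : Matrix.ProjGenLinGroup.mk A • Projectivization.mk ℂ w hw = Projectivization.mk ℂ w' hw') :
    ∃ c : ℂ, c ≠ 0 ∧ (A : Matrix (Fin 4) (Fin 4) ℂ).mulVec w = c • w' := by
  rw [Projectivization.PGL.mk_smul_mk, Projectivization.mk_eq_mk_iff] at h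
  obtain ⟨c, hc⟩ := h
  exact ⟨c, c.ne_zero, hc.symm⟩

lemma smul_mk_eq {A : GL (Fin 4) ℂ} {w w' : Fin 4 → ℂ} {hw : w ≠ 0} {hw' : w' ≠ 0} {c : ℂ}
    (h : (A : Matrix (Fin 4) (Fin 4) ℂ).mulVec w = c • w') :
    Matrix.ProjGenLinGroup.mk A • Projectivization.mk ℂ w hw = Projectivization.mk ℂ w' hw' := by
  rw [Projectivization.PGL.mk_smul_mk, Projectivization.mk_eq_mk_iff']
  exact ⟨c, h.symm⟩

/-- A projectivity of type (C) permutes the twelve points cyclically. As the points represented by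
its rows are pairwise orthogonal, they are mapped to the coordinate points. -/
lemma IsReye.exists_perm {A : GL (Fin 4) ℂ} (hA : Matrix.ProjGenLinGroup.mk A ∈ cremonaCubes)
    {u v : Fin 4 → Fin 4 → ℂ} (h : IsReye u v)
    (hcol : Set.range (colPt A)
      = Set.range fun j => Projectivization.mk ℂ (u j) (ne_zero_of_sq (h.sq_u j)))
    (hrow : Set.range (rowPt A)
      = Set.range fun j => Projectivization.mk ℂ (v j) (ne_zero_of_sq (h.sq_v j))) :
    (∃ σ : Equiv.Perm (Fin 4), ∀ j, Matrix.ProjGenLinGroup.mk A • ePt j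
      = Projectivization.mk ℂ (u (σ j)) (ne_zero_of_sq (h.sq_u _))) ∧
    (∃ σ : Equiv.Perm (Fin 4), ∀ j, Matrix.ProjGenLinGroup.mk A •
      Projectivization.mk ℂ (u j) (ne_zero_of_sq (h.sq_u j))
      = Projectivization.mk ℂ (v (σ j)) (ne_zero_of_sq (h.sq_v _))) ∧
    (∃ σ : Equiv.Perm (Fin 4), ∀ j, Matrix.ProjGenLinGroup.mk A •
      Projectivization.mk ℂ (v j) (ne_zero_of_sq (h.sq_v j)) = ePt (σ j)) := by
  have perm : ∀ {x y : Fin 4 → P3}, Function.Injective x →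
      (∀ j, ∃ i, Matrix.ProjGenLinGroup.mk A • x j = y i) →
      ∃ σ : Equiv.Perm (Fin 4), ∀ j, Matrix.ProjGenLinGroup.mk A • x j = y (σ j) := by
    intro x y hx hxy
    choose f hf using hxy
    have hinj : Function.Injective f := fun i j hij => hx <| by
      have := hf i
      rw [hij, ← hf j] at this
      exact smul_left_cancel _ this
    exact ⟨Equiv.ofBijective f (Finite.injective_iff_bijective.mp hinj), hf⟩
  have hE := perm (x := ePt)
    (y := fun j => Projectivization.mk ℂ (u j) (ne_zero_of_sq (h.sq_u j))) ePt_injective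
    fun j => by
      have : colPt A j ∈ Set.range (colPt A) := ⟨j, rfl⟩
      rw [hcol, colPt_eq] at this
      obtain ⟨i, hi⟩ := this
      exact ⟨i, hi.symm⟩
  have hV := perm (y := ePt) h.inj_v fun j => by
    have h1 : ∀ i, ∃ k, Projectivization.mk ℂ (v k) (ne_zero_of_sq (h.sq_v k)) = rowPt A i :=
      fun i => by
        have : rowPt A i ∈ Set.range (rowPt A) := ⟨i, rfl⟩
        rwa [hrow] at this
    choose τ hτ using h1
    have hsurj : Function.Surjective τ := fun k => by
      have : Projectivization.mk ℂ (v k) (ne_zero_of_sq (h.sq_v k)) ∈ Set.range (rowPt A) := by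
        rw [hrow]
        exact ⟨k, rfl⟩
      obtain ⟨i, hi⟩ := this
      exact ⟨i, h.inj_v ((hτ i).trans hi)⟩
    have hinj := Finite.injective_iff_surjective.mpr hsurj
    have h2 : ∀ i, ∃ c : ℂ, c • v (τ i) = fun j => (A : Matrix (Fin 4) (Fin 4) ℂ) i j := fun i =>
      (Projectivization.mk_eq_mk_iff' _ _ _ _ _).mp (hτ i).symm
    choose c hc using h2
    obtain ⟨i, rfl⟩ := hsurj j
    refine ⟨i, smul_mk_eq (c := c i * 4) ?_⟩
    ext k
    have h3 : (A : Matrix (Fin 4) (Fin 4) ℂ).mulVec (v (τ i)) k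
        = c k * ∑ m, v (τ k) m * v (τ i) m := by
      rw [Finset.mul_sum]
      change ∑ m : Fin 4, (A : Matrix (Fin 4) (Fin 4) ℂ) k m * v (τ i) m = _
      refine Finset.sum_congr rfl fun m _ => ?_
      have := congrFun (hc k) m
      simp only [Pi.smul_apply, smul_eq_mul] at this
      rw [← mul_assoc, this]
    rw [h3, h.orthogonal]
    rcases eq_or_ne k i with rfl | hki
    · simp
    · simp [hki, hinj.ne hki]
  refine ⟨hE, perm (y := fun j => Projectivization.mk ℂ (v j) (ne_zero_of_sq (h.sq_v j)))
    h.inj_u fun j => ?_, hV⟩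
  obtain ⟨σ, hσ⟩ := hE
  obtain ⟨τ, hτ⟩ := hV
  have hmem := hA _ ((h.mem_iff _).mpr (.inr (.inl ⟨j, rfl⟩)))
  rcases (h.mem_iff _).mp hmem with ⟨i, hi⟩ | ⟨i, hi⟩ | ⟨i, hi⟩
  · have := hτ (τ.symm i)
    rw [Equiv.apply_symm_apply, hi] at this
    exact absurd (smul_left_cancel _ this).symm (h.u_ne_v _ _)
  · have := hσ (σ.symm i)
    simp only [Equiv.apply_symm_apply, hi] at this
    exact absurd (smul_left_cancel _ this) (ePt_ne_mk (h.sq_u j) _ _)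
  · exact ⟨i, hi.symm⟩

lemma IsReye.isCycle {A : GL (Fin 4) ℂ} (hA : Matrix.ProjGenLinGroup.mk A ∈ cremonaCubes)
    {u v : Fin 4 → Fin 4 → ℂ} (h : IsReye u v)
    (hcol : Set.range (colPt A)
      = Set.range fun j => Projectivization.mk ℂ (u j) (ne_zero_of_sq (h.sq_u j)))
    (hrow : Set.range (rowPt A)
      = Set.range fun j => Projectivization.mk ℂ (v j) (ne_zero_of_sq (h.sq_v j))) :
    IsCycle A u v := by
  obtain ⟨⟨σ, hσ⟩, ⟨τ, hτ⟩, ⟨ρ, hρ⟩⟩ := h.exists_perm hA hcol hrow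
  exact ⟨h.sq_u, h.sq_v, ⟨σ, fun j => exists_mulVec_eq_smul (hσ j)⟩,
    ⟨τ, fun j => exists_mulVec_eq_smul (hτ j)⟩, ⟨ρ, fun j => exists_mulVec_eq_smul (hρ j)⟩⟩

lemma sum_excClass_imgPt {A : GL (Fin 4) ℂ}
    (hA : Matrix.ProjGenLinGroup.mk A ∈ cremonaCubes) {x y : Fin 4 → P3} (hx : ∀ j, x j ∈ reye)
    (hy : ∀ j, y j ∈ reye) {σ : Equiv.Perm (Fin 4)}
    (h : ∀ j, Matrix.ProjGenLinGroup.mk A • x j = y (σ j)) :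
    ∑ j, excClass reye _ (imgPt hA (x j) (hx j)).2 = ∑ j, excClass reye (y j) (hy j) := by
  rw [← Equiv.sum_comp σ fun j => excClass reye (y j) (hy j)]
  refine Finset.sum_congr rfl fun j _ => ?_
  have key : ∀ {a b : P3} (ha : a ∈ reye) (hb : b ∈ reye), a = b →
      excClass reye a ha = excClass reye b hb := by
    rintro a _ ha hb rfl
    rfl
  exact key _ _ (h j)

lemma IsReye.pushforward_pow {A : GL (Fin 4) ℂ}
    (hA : Matrix.ProjGenLinGroup.mk A ∈ cremonaCubes)
    {u v : Fin 4 → Fin 4 → ℂ} (h : IsReye u v)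
    (hcol : Set.range (colPt A)
      = Set.range fun j => Projectivization.mk ℂ (u j) (ne_zero_of_sq (h.sq_u j)))
    (hrow : Set.range (rowPt A)
      = Set.range fun j => Projectivization.mk ℂ (v j) (ne_zero_of_sq (h.sq_v j)))
    (hu : ∀ j, Projectivization.mk ℂ (u j) (ne_zero_of_sq (h.sq_u j)) ∈ reye)
    (hv : ∀ j, Projectivization.mk ℂ (v j) (ne_zero_of_sq (h.sq_v j)) ∈ reye)
    {d f b c : ℕ → ℤ} (h0 : d 0 = 1 ∧ f 0 = 0 ∧ b 0 = 0 ∧ c 0 = 0)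
    (hrec : ∀ n, d (n + 1) = 3 * d n - 4 * f n ∧ f (n + 1) = c n ∧
      b (n + 1) = 2 * d n - 3 * f n ∧ c (n + 1) = b n) (n : ℕ) :
    (pushforward reye ((projectivity A).comp cremona) ^ n) (planeClass reye)
      = d n • planeClass reye - f n • ∑ j, excClass reye (ePt j) (ePt_mem j)
        - b n • ∑ j, excClass reye _ (hu j) - c n • ∑ j, excClass reye _ (hv j) := by
  obtain ⟨⟨σ, hσ⟩, ⟨τ, hτ⟩, ⟨ρ, hρ⟩⟩ := h.exists_perm hA hcol hrow
  have hEU := sum_excClass_imgPt hA ePt_mem hu hσ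
  refine pow_apply_of_cycle (pushforward reye ((projectivity A).comp cremona)) ?_ ?_ ?_ ?_ h0 hrec n
  · rw [pushforward_planeClass hA, hEU]
  · rw [map_sum]
    simp only [pushforward_excClass_ePt hA]
    rw [Finset.sum_sub_distrib, Finset.sum_sub_distrib, hEU]
    simp only [Finset.sum_const, Finset.card_univ, Fintype.card_fin]
    module
  · rw [map_sum]
    simp only [pushforward_excClass_of_sq hA (h.sq_u _)]
    exact sum_excClass_imgPt hA hu hv hτ
  · rw [map_sum]
    simp only [pushforward_excClass_of_sq hA (h.sq_v _)]
    exact sum_excClass_imgPt hA hv ePt_mem hρ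

/-! ### Growth of the degrees -/

lemma inv_goldenRatio_pow (n : ℕ) :
    (Real.goldenRatio ^ (2 * n))⁻¹ = (Real.goldenConj ^ 2) ^ n := by
  rw [pow_mul, ← inv_pow, ← inv_pow, Real.inv_goldenRatio, neg_sq]

/-- The closed form of `d_n`, proved together with those of `f_n`, `b_n` and `c_n`; with
`s_n = φ ^ (2 n) + φ ^ (-2 n)` the term `3 s_n - s_{n+1}` in `f_n` stands for `s_{n-1}`. -/
lemma degree_closed_form {d f b c : ℕ → ℤ} (h0 : d 0 = 1 ∧ f 0 = 0 ∧ b 0 = 0 ∧ c 0 = 0)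
    (h : ∀ n, d (n + 1) = 3 * d n - 4 * f n ∧ f (n + 1) = c n ∧
      b (n + 1) = 2 * d n - 3 * f n ∧ c (n + 1) = b n) (n : ℕ) :
    (d n : ℝ) = 8 / 5 * (Real.goldenRatio ^ (2 * n) + (Real.goldenRatio ^ (2 * n))⁻¹)
      - (-1) ^ n / 5 - 2 := by
  set s : ℕ → ℝ := fun n => (Real.goldenRatio ^ 2) ^ n + (Real.goldenConj ^ 2) ^ n with hs
  have h1 : Real.goldenRatio ^ 2 + Real.goldenConj ^ 2 = 3 := by
    rw [Real.goldenRatio_sq, Real.goldenConj_sq]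
    linear_combination Real.goldenRatio_add_goldenConj
  have h2 : Real.goldenRatio ^ 2 * Real.goldenConj ^ 2 = 1 := by
    rw [← mul_pow, Real.goldenRatio_mul_goldenConj]
    norm_num
  have hrec : ∀ n, s (n + 2) = 3 * s (n + 1) - s n := fun n => by
    simp only [hs]
    linear_combination ((Real.goldenRatio ^ 2) ^ (n + 1) + (Real.goldenConj ^ 2) ^ (n + 1)) * h1
      - ((Real.goldenRatio ^ 2) ^ n + (Real.goldenConj ^ 2) ^ n) * h2
  have hs0 : s 0 = 2 := by norm_num [hs]
  have hs1 : s 1 = 3 := by simpa only [hs, pow_one] using h1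
  have key : ∀ n, (d n : ℝ) = 8 / 5 * s n - (-1) ^ n / 5 - 2 ∧
      (f n : ℝ) = 2 / 5 * (3 * s n - s (n + 1)) - (-1) ^ n / 5 - 1 ∧
      (b n : ℝ) = 2 / 5 * s (n + 1) - (-1) ^ n / 5 - 1 ∧
      (c n : ℝ) = 2 / 5 * s n + (-1) ^ n / 5 - 1 := by
    intro n
    induction n with
    | zero =>
      rw [h0.1, h0.2.1, h0.2.2.1, h0.2.2.2, hs0, hs1]
      norm_num
    | succ n ih =>
      obtain ⟨e1, e2, e3, e4⟩ := h n
      obtain ⟨i1, i2, i3, i4⟩ := ih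
      rw [e1, e2, e3, e4, hrec n, pow_succ]
      push_cast
      rw [i1, i2, i3, i4]
      refine ⟨?_, ?_, ?_, ?_⟩ <;> ring
  rw [(key n).1, inv_goldenRatio_pow, pow_mul]

lemma tendsto_log_div {d : ℕ → ℝ}
    (hd : ∀ n, d n = 8 / 5 * (Real.goldenRatio ^ (2 * n) + (Real.goldenRatio ^ (2 * n))⁻¹)
      - (-1) ^ n / 5 - 2) :
    Tendsto (fun n : ℕ => 1 / (n : ℝ) * Real.log (d n)) atTop
      (𝓝 (2 * Real.log Real.goldenRatio)) := by
  set q : ℝ := (Real.goldenRatio ^ 2)⁻¹ with hq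
  have hφ := Real.goldenRatio_pos
  have hφ1 := Real.one_lt_goldenRatio
  have hq0 : 0 < q := by positivity
  have hq1 : q < 1 := inv_lt_one_of_one_lt₀ (one_lt_pow₀ hφ1 two_ne_zero)
  have hlim : ∀ r : ℝ, |r| < 1 → Tendsto (fun n : ℕ => r ^ n) atTop (𝓝 0) := fun r hr =>
    tendsto_pow_atTop_nhds_zero_of_abs_lt_one hr
  -- `d n = φ ^ (2 n) r n`, where `r n` tends to `8 / 5`
  set r : ℕ → ℝ := fun n => 8 / 5 * (1 + (q ^ 2) ^ n) - (-q) ^ n / 5 - 2 * q ^ n with hr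
  have hrlim : Tendsto r atTop (𝓝 (8 / 5)) := by
    have h1 := hlim (q ^ 2) (by
      rw [abs_of_pos (by positivity)]
      exact pow_lt_one₀ hq0.le hq1 two_ne_zero)
    have h2 := hlim (-q) (by rwa [abs_neg, abs_of_pos hq0])
    have h3 := hlim q (by rwa [abs_of_pos hq0])
    have := ((((h1.const_add 1).const_mul (8 / 5)).sub (h2.div_const 5)).sub (h3.const_mul 2))
    simpa using this
  have hdr : ∀ n, d n = Real.goldenRatio ^ (2 * n) * r n := fun n => by
    have h1 : (Real.goldenRatio ^ 2) ^ n * q ^ n = 1 := by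
      rw [← mul_pow, hq, mul_inv_cancel₀ (by positivity), one_pow]
    have h2 : (-q) ^ n = (-1) ^ n * q ^ n := by rw [← mul_pow]; ring_nf
    have h3 : ((Real.goldenRatio ^ 2) ^ n)⁻¹ = q ^ n := by rw [hq, inv_pow]
    rw [hd, hr, pow_mul, h3]
    simp only [h2, pow_right_comm q 2 n]
    linear_combination (-(8 / 5) * q ^ n + (-1) ^ n / 5 + 2) * h1
  have hlog : Tendsto (fun n : ℕ => 2 * Real.log Real.goldenRatio + 1 / (n : ℝ) * Real.log (r n))
      atTop (𝓝 (2 * Real.log Real.goldenRatio + 0 * Real.log (8 / 5))) :=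
    tendsto_const_nhds.add (tendsto_one_div_atTop_nhds_zero_nat.mul
      ((Real.continuousAt_log (by norm_num)).tendsto.comp hrlim))
  rw [zero_mul, add_zero] at hlog
  refine hlog.congr' ?_
  filter_upwards [hrlim.eventually_ne (by norm_num : (8 / 5 : ℝ) ≠ 0), eventually_ne_atTop 0]
    with n hn hn0
  rw [hdr, Real.log_mul (by positivity) hn, Real.log_pow]
  have : (n : ℝ) ≠ 0 := by exact_mod_cast hn0
  push_cast
  field_simp

/-- The sequence of vectors `(d_n, f_n, b_n, c_n)` defined by the recurrence. -/
def multSeq : ℕ → ℤ × ℤ × ℤ × ℤ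
  | 0 => (1, 0, 0, 0)
  | n + 1 => (3 * (multSeq n).1 - 4 * (multSeq n).2.1, (multSeq n).2.2.2,
      2 * (multSeq n).1 - 3 * (multSeq n).2.1, (multSeq n).2.2.1)

end CremonaCubes

open CremonaCubes
theorem mainTheorem3 (A : GL (Fin 4) ℂ) (hA : IsTypeC A) :
    -- the classes `H`, `E_j`, `P_j`, `Q_j` form a basis of the divisor class group
    (∀ D : DivClassGroup reye, ∃! m : ℤ × (Fin 4 → ℤ) × (Fin 4 → ℤ) × (Fin 4 → ℤ),
      D = m.1 • planeClass reye + ∑ j, m.2.1 j • excClass reye (ePt j) (ePt_mem j)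
        + ∑ j, m.2.2.1 j • excClass reye (pPt j) (pPt_mem j)
        + ∑ j, m.2.2.2 j • excClass reye (qPt j) (qPt_mem j)) ∧
    ∃ d f b c : ℕ → ℤ,
      -- initial conditions and recurrence
      (d 0 = 1 ∧ f 0 = 0 ∧ b 0 = 0 ∧ c 0 = 0) ∧
      (∀ n, d (n + 1) = 3 * d n - 4 * f n ∧ f (n + 1) = c n ∧
        b (n + 1) = 2 * d n - 3 * f n ∧ c (n + 1) = b n) ∧
      -- the action of `Φ = g ∘ C₃` on the class of a plane
      (ColsPRowsQ A → ∀ n, (pushforward reye ((projectivity A).comp cremona) ^ n) (planeClass reye)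
        = d n • planeClass reye - f n • ∑ j, excClass reye (ePt j) (ePt_mem j)
          - b n • ∑ j, excClass reye (pPt j) (pPt_mem j)
          - c n • ∑ j, excClass reye (qPt j) (qPt_mem j)) ∧
      (ColsQRowsP A → ∀ n, (pushforward reye ((projectivity A).comp cremona) ^ n) (planeClass reye)
        = d n • planeClass reye - f n • ∑ j, excClass reye (ePt j) (ePt_mem j)
          - b n • ∑ j, excClass reye (qPt j) (qPt_mem j)
          - c n • ∑ j, excClass reye (pPt j) (pPt_mem j)) ∧
      -- degrees of the iterates, closed form, entropy
      (∀ n, ((((projectivity A).comp cremona).iterate n).degree : ℤ) = d n) ∧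
      (∀ n, (d n : ℝ) = 8 / 5 * (Real.goldenRatio ^ (2 * n) + (Real.goldenRatio ^ (2 * n))⁻¹)
        - (-1) ^ n / 5 - 2) ∧
      ((projectivity A).comp cremona).HasAlgebraicEntropy (2 * Real.log Real.goldenRatio) ∧
      0 < 2 * Real.log Real.goldenRatio := by
  obtain ⟨hmem, htype⟩ := hA
  set d : ℕ → ℤ := fun n => (multSeq n).1
  set f : ℕ → ℤ := fun n => (multSeq n).2.1
  set b : ℕ → ℤ := fun n => (multSeq n).2.2.1
  set c : ℕ → ℤ := fun n => (multSeq n).2.2.2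
  have h0 : d 0 = 1 ∧ f 0 = 0 ∧ b 0 = 0 ∧ c 0 = 0 := ⟨rfl, rfl, rfl, rfl⟩
  have hrec : ∀ n, d (n + 1) = 3 * d n - 4 * f n ∧ f (n + 1) = c n ∧
      b (n + 1) = 2 * d n - 3 * f n ∧ c (n + 1) = b n := fun n => ⟨rfl, rfl, rfl, rfl⟩
  have hdeg : ∀ n, ((((projectivity A).comp cremona).iterate n).degree : ℤ) = d n := by
    rcases htype with h | h
    · exact degree_iterate (isReye_pVec_qVec.isCycle hmem h.1 h.2) h0 hrec
    · exact degree_iterate (isReye_qVec_pVec.isCycle hmem h.1 h.2) h0 hrec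
  have hform := degree_closed_form h0 hrec
  refine ⟨existsUnique_reye, d, f, b, c, h0, hrec,
    fun h n => isReye_pVec_qVec.pushforward_pow hmem h.1 h.2 pPt_mem qPt_mem h0 hrec n,
    fun h n => isReye_qVec_pVec.pushforward_pow hmem h.1 h.2 qPt_mem pPt_mem h0 hrec n,
    hdeg, hform, ?_, mul_pos two_pos (Real.log_pos Real.one_lt_goldenRatio)⟩
  have h := tendsto_log_div hform
  simp only [← hdeg, Int.cast_natCast] at h
  exact h
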